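/- Let $G$ be a finite connected graph with vertex set $V$, without loops, whose edges $e$ carry positive weights $\omega(e)$. The random walk on $G$ moves from a vertex $u$ to a neighbour $v$ with probability proportional to $\omega(uv)$; the hitting time $H_G(u,v)$ is the expected number of steps it takes to get from $u$ to $v$ (so $H_G(u,u)=0$), and the average hitting time is $\alpha(G)=\frac{1}{|V|^2}\sum_{u\in V}\sum_{v\in V}H_G(u,v)$. For a finite multiset $W$ of positive real numbers, let $\mathcal{T}_W$ be the class of all weighted trees $T$ whose edge-weights, counted with multiplicity, form the multiset $W$, and let $S_W$ be the element of $\mathcal{T}_W$ (unique up to isomorphism) whose underlying graph is a star. A path $P=v_1v_2\cdots v_n$ in $\mathcal{T}_W$, with edges $e_i=v_iv_{i+1}$ and $c(e_i)=\min\{i,n-i\}$ for $1\le i\le n-1$, is called polarized if $\omega(e_i)\ge\omega(e_j)$ whenever $c(e_i)<c(e_j)$. Theorem. For every finite multiset $W$ of positive real numbers, polarized paths exist in $\mathcal{T}_W$, and an element of $\mathcal{T}_W$ maximizes $\alpha$ over $\mathcal{T}_W$ if and only if it is a polarized path. An element of $\mathcal{T}_W$ minimizes $\alpha$ over $\mathcal{T}_W$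 if and only if it is isomorphic, as a weighted graph, to $S_W$. -/

import Mathlib

open MeasureTheory ProbabilityTheory
open scoped ENNReal

universe u v

/-- A weighted graph without loops on the vertex set `V`: the edges carry positive weights,
and all other unordered pairs have weight `0`. -/
structure WeightedGraph (V : Type u) where
  /-- the underlying simple graph -/
  graph : SimpleGraph V
  /-- the edge-weights `ω` -/
  weight : Sym2 V → ℝ
  weight_pos : ∀ e ∈ graph.edgeSet, 0 < weight e
  weight_eq_zero : ∀ e ∉ graph.edgeSet, weight e = 0

namespace WeightedGraph

/-- An isomorphism of weighted graphs: a graph isomorphism preserving the weights. -/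
structure Iso {V : Type u} {V' : Type v} (G : WeightedGraph V) (G' : WeightedGraph V') where
  toIso : G.graph ≃g G'.graph
  weight_map : ∀ x y : V, G'.weight s(toIso x, toIso y) = G.weight s(x, y)

lemma weight_nonneg {V : Type u} (G : WeightedGraph V) (e : Sym2 V) : 0 ≤ G.weight e := by
  by_cases h : e ∈ G.graph.edgeSet
  · exact (G.weight_pos e h).le
  · exact (G.weight_eq_zero e h).ge

section Basic

variable {V : Type u} [Fintype V] (G : WeightedGraph V)

open Classical in
/-- The multiset of the weights of the edges of `G`. -/
noncomputable def edgeWeights : Multiset ℝ :=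
  G.graph.edgeFinset.val.map G.weight

/-- `G` belongs to the class of weighted trees whose edge-weights form the multiset `W`. -/
def IsTreeWithWeights (W : Multiset ℝ) : Prop :=
  G.graph.IsTree ∧ G.edgeWeights = W

/-- The (weighted) degree of a vertex. -/
noncomputable def degree (x : V) : ℝ := ∑ y, G.weight s(x, y)

lemma degree_nonneg (x : V) : 0 ≤ G.degree x :=
  Finset.sum_nonneg fun _ _ => G.weight_nonneg _

end Basic

section RandomWalk

variable {V : Type u} [Fintype V] [MeasurableSpace V] [DiscreteMeasurableSpace V]
  (G : WeightedGraph V)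

open Classical in
/-- The law of one step of the random walk from `x`: it moves to `y` with probability
`ω(xy) / d(x)`. A vertex of degree `0` (in a connected graph, this occurs only if it is the
only vertex) has nowhere to go, and the walk stays there. -/
noncomputable def stepMeasure (x : V) : Measure V :=
  if G.degree x = 0 then Measure.dirac x
  else ∑ y, ENNReal.ofReal (G.weight s(x, y) / G.degree x) • Measure.dirac y

instance (x : V) : IsProbabilityMeasure (G.stepMeasure x) := by
  unfold stepMeasure
  split_ifs with h
  · infer_instance
  · refine ⟨?_⟩
    have h0 : ∀ y ∈ Finset.univ, 0 ≤ G.weight s(x, y) / G.degree x := fun y _ =>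
      div_nonneg (G.weight_nonneg _) (G.degree_nonneg x)
    have h1 : ∑ y, G.weight s(x, y) / G.degree x = 1 := by
      rw [← Finset.sum_div]
      exact div_self h
    simp [Measure.finsetSum_apply, ← ENNReal.ofReal_sum_of_nonneg h0, h1]

/-- The transition kernel of the random walk on `G`. -/
noncomputable def stepKernel : Kernel V V where
  toFun := G.stepMeasure
  measurable' := Measurable.of_discrete

instance : IsMarkovKernel G.stepKernel :=
  ⟨fun x => inferInstanceAs (IsProbabilityMeasure (G.stepMeasure x))⟩

/-- The step of the random walk at time `n`, as a kernel from the history up to time `n`: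
it depends only on the current position. -/
noncomputable def historyKernel (n : ℕ) : Kernel (Finset.Iic n → V) V :=
  G.stepKernel.comap (fun h => h ⟨n, Finset.mem_Iic.2 le_rfl⟩) (measurable_pi_apply _)

instance (n : ℕ) : IsMarkovKernel (G.historyKernel n) := by
  unfold historyKernel
  infer_instance

/-- The law, on the space of trajectories `ℕ → V`, of the random walk on `G` started from `x`. -/
noncomputable def walkLaw (x : V) : Measure (ℕ → V) :=
  Kernel.traj (X := fun _ => V) G.historyKernel 0 (fun _ => x)

end RandomWalk

/-- The first time `t ≥ 0` at which a trajectory visits `y` (`∞` if it never does). -/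
noncomputable def firstHit {V : Type u} (y : V) (X : ℕ → V) : ℝ≥0∞ :=
  ⨅ (t : ℕ) (_ : X t = y), (t : ℝ≥0∞)

section HittingTime

variable {V : Type u} [Fintype V] (G : WeightedGraph V)

/-- The hitting time `H_G(x, y)`: the expected number of steps that the random walk on `G`
takes to get from `x` to `y`. -/
noncomputable def hittingTime (x y : V) : ℝ≥0∞ :=
  letI : MeasurableSpace V := ⊤
  ∫⁻ X, firstHit y X ∂(G.walkLaw x)

/-- The average hitting time `α(G)`, the arithmetic mean of all hitting times. -/
noncomputable def averageHittingTime : ℝ≥0∞ :=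
  (∑ x, ∑ y, G.hittingTime x y) / (Fintype.card V : ℝ≥0∞) ^ 2

/-- `G` is a polarized path: its vertices can be enumerated as `v₁, …, vₙ`, the edges being
exactly the `eᵢ = vᵢvᵢ₊₁` for `1 ≤ i ≤ n - 1`, such that with `c(eᵢ) = min (i, n - i)` one has
`ω(eᵢ) ≥ ω(eⱼ)` whenever `c(eᵢ) < c(eⱼ)`. As `Fin n` counts from `0`, the edge between the
vertices number `i` and `i + 1` of `Fin n` is `eᵢ₊₁`. -/
def IsPolarizedPath : Prop :=
  ∃ p : SimpleGraph.pathGraph (Fintype.card V) ≃g G.graph,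
    ∀ (i j : ℕ) (hi : i + 1 < Fintype.card V) (hj : j + 1 < Fintype.card V),
      min (i + 1) (Fintype.card V - (i + 1)) < min (j + 1) (Fintype.card V - (j + 1)) →
        G.weight s(p ⟨j, by omega⟩, p ⟨j + 1, hj⟩) ≤ G.weight s(p ⟨i, by omega⟩, p ⟨i + 1, hi⟩)

end HittingTime

section Star

/-- The edge-weights of the star: the centre is `none`, the leaves are the elements of `W`
(with multiplicity), and the edge from the centre to the leaf `a` has weight `a`. -/
noncomputable def starWeight (W : Multiset ℝ) : Sym2 (Option W) → ℝ :=
  Sym2.lift ⟨fun x y => match x, y with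
    | none, some a => a.1
    | some a, none => a.1
    | _, _ => 0, by rintro (_ | a) (_ | b) <;> rfl⟩

/-- The weighted star `S_W`. -/
noncomputable def star (W : Multiset ℝ) (hW : ∀ w ∈ W, 0 < w) : WeightedGraph (Option W) where
  graph := SimpleGraph.starGraph none
  weight := starWeight W
  weight_pos := by
    intro e
    induction e using Sym2.ind with
    | _ x y =>
      rcases x with _ | a <;> rcases y with _ | b
      · simp
      · intro _
        exact hW _ Multiset.coe_mem
      · intro _
        exact hW _ Multiset.coe_mem
      · simp
  weight_eq_zero := by
    intro e
    induction e using Sym2.ind with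
    | _ x y =>
      rcases x with _ | a <;> rcases y with _ | b <;> simp [starWeight]

end Star

end WeightedGraph

/-!
For a tree `G` on `n` vertices with total weight `Ω`, deleting the edge `ab` leaves two branches.
A walk that has to cross `ab` from `a` to `b` needs on average `d(A) / ω(ab)` steps to do so, where
`d(A)` is the total degree of the branch `A` of `a`, and these times add up along the path between
two vertices (`hittingTime_eq`). It is enough to check that this formula is a finite solution of
the first-step equations: a martingale argument identifies every finite solution with the hitting
times (`lintegral_firstHit_eq`). Summing over all pairs, an edge with `k` vertices on one side is
counted `k (n - k)` times in each direction, and the two directions contribute `d(V) = 2Ω`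
together, so that `α(G) = 2Ω / n² * ∑ k (n - k) / ω(e)` (`averageHittingTime_eq`). Let `c(e)` be
the smaller of `k` and `n - k`; it remains to optimize `∑ c(e) (n - c(e)) / ω(e)`.

The minimum is immediate: each term is at least `(n - 1) / ω(e)`, with equality only for pendant
edges, and a tree all of whose edges are pendant is a star.

For the maximum, `c (n - c)` is the sum of the positive numbers `n + 1 - 2j` over `1 ≤ j ≤ c`, so
the sum is a positive combination of the sums of `1 / ω(e)` over the edges with `c(e) ≥ j`. There
are at most `n + 1 - 2j` such edges (`IsTree.card_le_edgeBalance`), and exactly that many in a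
path. In a polarized path they also have the smallest weights, so that all levels are maximal at
the same time. Conversely, equality forces the same numbers of edges at each level, hence at most
two pendant edges when `n ≥ 4`, so that the tree is a path; and it forces each level to consist of
edges of the smallest weights, which means that the path is polarized (`sum_mul_sub_le`).
-/

/-! ### Branches of a tree -/

namespace SimpleGraph

variable {V : Type u} {G : SimpleGraph V}

lemma Connected.forall_of_adj (hG : G.Connected) {P : V → Prop}
    (hP : ∀ p q, G.Adj p q → P p → P q) {a : V} (ha : P a) (v : V) : P v := by
  obtain ⟨w⟩ := hG.preconnected a v
  induction w with
  | nil => exact ha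
  | cons h _ ih => exact ih (hP _ _ h ha)

/-- In a connected graph, a set of vertices that no edge leaves and that is not everything is
empty. -/
lemma Connected.not_of_adj (hG : G.Connected) {P : V → Prop}
    (hP : ∀ p q, G.Adj p q → P p → P q) {a : V} (ha : ¬ P a) (v : V) : ¬ P v :=
  hG.forall_of_adj (P := fun x => ¬ P x) (fun p q h hp hq => hp (hP q p h.symm hq)) ha v

variable [Fintype V]

open Classical in
/-- The branch of `G` seen from `a` in the direction of the neighbour `b`: the vertices that can
still be reached from `b` once the edge `ab` is deleted. In a tree, deleting `ab` leaves the two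
components `G.branch a b` and `G.branch b a`. -/
noncomputable def branch (G : SimpleGraph V) (a b : V) : Finset V :=
  {v | (G.deleteEdges {s(a, b)}).Reachable b v}

lemma mem_branch {a b v : V} :
    v ∈ G.branch a b ↔ (G.deleteEdges {s(a, b)}).Reachable b v := by
  simp [branch]

lemma right_mem_branch (a b : V) : b ∈ G.branch a b := mem_branch.2 (Reachable.refl _)

lemma IsTree.left_notMem_branch (hG : G.IsTree) {a b : V} (h : G.Adj a b) :
    a ∉ G.branch a b := by
  rw [mem_branch]
  have := isAcyclic_iff_forall_adj_isBridge.1 hG.isAcyclic h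
  rw [isBridge_iff] at this
  exact fun h' => this h'.symm

/-- The only edge that leaves the branch of `b` seen from `a` is `ba`. -/
lemma eq_of_adj_of_mem_branch {a b p q : V} (h : G.Adj p q) (hp : p ∈ G.branch a b)
    (hq : q ∉ G.branch a b) : p = b ∧ q = a := by
  rw [mem_branch] at hp hq
  by_cases he : s(p, q) = s(a, b)
  · rcases Sym2.eq_iff.1 he with ⟨rfl, rfl⟩ | ⟨rfl, rfl⟩
    · exact absurd (Reachable.refl _) hq
    · exact ⟨rfl, rfl⟩
  · exact absurd (hp.trans (Adj.reachable (by simp [deleteEdges_adj, h, he]))) hq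

/-- The branches are the only vertex sets whose boundary is a single edge. -/
lemma IsTree.branch_eq (hG : G.IsTree) {a b : V} (hab : G.Adj a b) {U : Finset V} (ha : a ∉ U)
    (hb : b ∈ U) (hU : ∀ p q, G.Adj p q → p ∈ U → q ∉ U → p = b ∧ q = a) :
    G.branch a b = U := by
  have ha' := hG.left_notMem_branch hab
  have hb' := right_mem_branch (G := G) a b
  ext v
  constructor
  · intro hv
    by_contra hvU
    refine hG.connected.not_of_adj (P := fun v => v ∈ G.branch a b ∧ v ∉ U) (a := a) ?_
      (by simp [ha']) v ⟨hv, hvU⟩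
    rintro p q hpq ⟨hp, hpU⟩
    by_contra hq
    by_cases hq' : q ∈ G.branch a b
    · have := hU q p hpq.symm (by simpa [hq'] using hq) hpU
      exact ha' (this.2 ▸ hp)
    · exact hpU ((eq_of_adj_of_mem_branch hpq hp hq').1 ▸ hb)
  · intro hv
    by_contra hvB
    refine hG.connected.not_of_adj (P := fun v => v ∈ U ∧ v ∉ G.branch a b) (a := a) ?_
      (by simp [ha]) v ⟨hv, hvB⟩
    rintro p q hpq ⟨hp, hpB⟩
    by_contra hq
    by_cases hq' : q ∈ U
    · have := eq_of_adj_of_mem_branch hpq.symm (by simpa [hq'] using hq) hpB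
      exact ha (this.2 ▸ hp)
    · exact hpB ((hU p q hpq hp hq').1 ▸ hb')

/-- The two branches at an edge of a tree are complementary. -/
lemma IsTree.mem_branch_swap (hG : G.IsTree) {a b : V} (h : G.Adj a b) (v : V) :
    v ∈ G.branch b a ↔ v ∉ G.branch a b := by
  classical
  rw [hG.branch_eq (a := b) (b := a) h.symm (U := (G.branch a b)ᶜ)
    (by simp [right_mem_branch]) (by simpa using hG.left_notMem_branch h)]
  · simp
  · intro p q hpq hp hq
    have := eq_of_adj_of_mem_branch hpq.symm (by simpa using hq) (by simpa using hp)
    exact this.symm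

open Classical in
lemma IsTree.branch_swap (hG : G.IsTree) {a b : V} (h : G.Adj a b) :
    G.branch b a = (G.branch a b)ᶜ := by
  ext v
  simp [hG.mem_branch_swap h]

lemma IsTree.card_branch_add (hG : G.IsTree) {a b : V} (h : G.Adj a b) :
    (G.branch a b).card + (G.branch b a).card = Fintype.card V := by
  classical
  rw [hG.branch_swap h, Finset.card_add_card_compl]

lemma card_branch_pos (a b : V) : 0 < (G.branch a b).card :=
  Finset.card_pos.2 ⟨b, right_mem_branch a b⟩

/-- The branches at a vertex are disjoint. -/
lemma IsTree.eq_of_mem_branch (hG : G.IsTree) {x z z' v : V} (hz : G.Adj x z) (hz' : G.Adj x z')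
    (hv : v ∈ G.branch x z) (hv' : v ∈ G.branch x z') : z = z' := by
  by_contra hne
  refine hG.connected.not_of_adj (P := fun v => v ∈ G.branch x z ∧ v ∈ G.branch x z') (a := x) ?_
    (by simp [hG.left_notMem_branch hz]) v ⟨hv, hv'⟩
  rintro p q hpq ⟨hp, hp'⟩
  by_contra hq
  by_cases hq' : q ∈ G.branch x z
  · obtain ⟨rfl, rfl⟩ := eq_of_adj_of_mem_branch hpq hp' (by simpa [hq'] using hq)
    exact hG.left_notMem_branch hz hq'
  · obtain ⟨rfl, rfl⟩ := eq_of_adj_of_mem_branch hpq hp hq'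
    exact hne (eq_of_adj_of_mem_branch hpq hp' (hG.left_notMem_branch hz')).1

/-- The branches at a vertex cover all other vertices. -/
lemma IsTree.exists_mem_branch (hG : G.IsTree) {x v : V} (hv : v ≠ x) :
    ∃ z, G.Adj x z ∧ v ∈ G.branch x z := by
  have := hG.connected.forall_of_adj
    (P := fun v => v = x ∨ ∃ z, G.Adj x z ∧ v ∈ G.branch x z) (a := x) ?_ (Or.inl rfl) v
  · exact this.resolve_left hv
  · rintro p q hpq (rfl | ⟨z, hz, hp⟩)
    · exact Or.inr ⟨q, hpq, right_mem_branch _ _⟩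
    · by_cases hq : q ∈ G.branch x z
      · exact Or.inr ⟨z, hz, hq⟩
      · exact Or.inl (eq_of_adj_of_mem_branch hpq hp hq).2

/-- The branch of an edge `cd` inside another branch is contained in the latter, if it is taken
in the direction that leads away from the root of the latter. -/
lemma IsTree.branch_ssubset (hG : G.IsTree) {a b c d : V} (hcd : G.Adj c d)
    (hc : c ∈ G.branch a b) (hd : d ∈ G.branch a b) (ha : a ∉ G.branch c d) :
    G.branch c d ⊂ G.branch a b := by
  refine (Finset.ssubset_iff_of_subset ?_).2 ⟨c, hc, hG.left_notMem_branch hcd⟩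
  intro v hv
  by_contra hvB
  refine hG.connected.not_of_adj (P := fun v => v ∈ G.branch c d ∧ v ∉ G.branch a b) (a := c) ?_
    (by simp [hc]) v ⟨hv, hvB⟩
  rintro p q hpq ⟨hp, hpB⟩
  by_contra hq
  by_cases hq' : q ∈ G.branch a b
  · exact ha ((eq_of_adj_of_mem_branch hpq.symm hq' hpB).2 ▸ hp)
  · have hq'' : q ∉ G.branch c d := fun h => hq ⟨h, hq'⟩
    exact hpB ((eq_of_adj_of_mem_branch hpq hp hq'').1 ▸ hd)

/-- An edge inside a branch has a side that is a strictly smaller branch. -/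
lemma IsTree.exists_branch_ssubset (hG : G.IsTree) {a b c d : V} (hcd : G.Adj c d)
    (hc : c ∈ G.branch a b) (hd : d ∈ G.branch a b) :
    G.branch c d ⊂ G.branch a b ∨ G.branch d c ⊂ G.branch a b := by
  by_cases ha : a ∈ G.branch c d
  · refine Or.inr (hG.branch_ssubset hcd.symm hd hc ?_)
    simp [hG.mem_branch_swap hcd, ha]
  · exact Or.inl (hG.branch_ssubset hcd hc hd ha)

/-! ### The balance of an edge -/

/-- The size of the smaller side of an edge. For the edges `eᵢ` of a path on `n` vertices this is
`min (i, n - i)`. -/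
noncomputable def edgeBalance (G : SimpleGraph V) : Sym2 V → ℕ :=
  Sym2.lift ⟨fun a b => min (G.branch a b).card (G.branch b a).card, fun _ _ => min_comm _ _⟩

@[simp]
lemma edgeBalance_mk (a b : V) :
    G.edgeBalance s(a, b) = min (G.branch a b).card (G.branch b a).card := rfl

lemma edgeBalance_pos (e : Sym2 V) : 0 < G.edgeBalance e := by
  induction e using Sym2.ind with
  | _ a b => exact lt_min (card_branch_pos a b) (card_branch_pos b a)

lemma IsTree.two_mul_edgeBalance_le (hG : G.IsTree) {e : Sym2 V} (he : e ∈ G.edgeSet) :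
    2 * G.edgeBalance e ≤ Fintype.card V := by
  induction e using Sym2.ind with
  | _ a b =>
    have := hG.card_branch_add (a := a) (b := b) he
    simp only [edgeBalance_mk]
    omega

/-- The endpoint of an edge that lies away from `r`; in the tree rooted at `r`, this is the
lower end of the edge. -/
lemma IsTree.exists_lower_end (hG : G.IsTree) (r : V) {e : Sym2 V} (he : e ∈ G.edgeSet) :
    ∃ x z, e = s(x, z) ∧ G.Adj x z ∧ r ∈ G.branch x z := by
  induction e using Sym2.ind with
  | _ a b =>
    have h : G.Adj a b := he
    by_cases hr : r ∈ G.branch a b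
    · exact ⟨a, b, rfl, h, hr⟩
    · exact ⟨b, a, Sym2.eq_swap, h.symm, (hG.mem_branch_swap h r).2 hr⟩

open Classical in
/-- A tree on `n` vertices has at most `n + 1 - 2j` edges with at least `j` vertices on either
side. Indeed, let `A` be a minimal branch among those of these edges, and `B` a minimal one
disjoint from `A`. None of these edges lies inside `A` or inside `B`. If the tree is rooted in
`A`, then the lower end of each of these edges is outside `A` and not in `B`, except possibly for
the top vertex of `B`. -/
lemma IsTree.card_le_edgeBalance (hG : G.IsTree) {j : ℕ} (hj : 2 * j ≤ Fintype.card V) :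
    (G.edgeFinset.filter fun e => j ≤ G.edgeBalance e).card + 2 * j ≤ Fintype.card V + 1 := by
  set E := G.edgeFinset.filter fun e => j ≤ G.edgeBalance e with hE
  rcases E.eq_empty_or_nonempty with h0 | ⟨e₀, he₀⟩
  · rw [h0]
    simp
    omega
  have memE : ∀ {x z}, s(x, z) ∈ E ↔ G.Adj x z ∧ j ≤ (G.branch x z).card ∧
      j ≤ (G.branch z x).card := by
    intro x z
    simp [hE]
  have memE' : ∀ {x z}, s(x, z) ∈ E → s(z, x) ∈ E := fun h => by rwa [Sym2.eq_swap]
  -- minimality of a branch excludes edges of `E` inside it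
  have inner : ∀ {a b}, s(a, b) ∈ E →
      (∀ c d, s(c, d) ∈ E → G.branch c d ⊆ G.branch a b →
        (G.branch a b).card ≤ (G.branch c d).card) →
      ∀ c d, s(c, d) ∈ E → c ∈ G.branch a b → d ∉ G.branch a b := by
    intro a b hab hmin c d hcd hc hd
    rcases hG.exists_branch_ssubset (memE.1 hcd).1 hc hd with h | h
    · exact (Finset.card_lt_card h).not_ge (hmin c d hcd h.subset)
    · exact (Finset.card_lt_card h).not_ge (hmin d c (memE' hcd) h.subset)
  have exmin : ∀ P : V × V → Prop, (∃ p, P p) → ∃ p, P p ∧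
      ∀ q, P q → (G.branch p.1 p.2).card ≤ (G.branch q.1 q.2).card := by
    intro P ⟨p, hp⟩
    obtain ⟨q, hq, hq'⟩ := (Finset.univ.filter P).exists_min_image
      (fun p => (G.branch p.1 p.2).card) ⟨p, by simpa using hp⟩
    exact ⟨q, by simpa using hq, fun r hr => hq' r (by simpa using hr)⟩
  obtain ⟨⟨a, b⟩, hab, hmin⟩ := exmin (fun p => s(p.1, p.2) ∈ E) (by
    induction e₀ using Sym2.ind with
    | _ x y => exact ⟨(x, y), he₀⟩)
  obtain ⟨⟨c, d⟩, ⟨hcd, hdisj⟩, hmin'⟩ := exmin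
    (fun p => s(p.1, p.2) ∈ E ∧ Disjoint (G.branch p.1 p.2) (G.branch a b))
    ⟨(b, a), memE' hab, by
      simp only
      rw [hG.branch_swap (memE.1 hab).1]
      exact disjoint_compl_left⟩
  simp only at hab hmin hcd hdisj hmin'
  have hA := inner hab fun x y hxy _ => hmin (x, y) hxy
  have hB := inner hcd fun x y hxy hs => hmin' (x, y) ⟨hxy, hdisj.mono_left hs⟩
  have hAj := (memE.1 hab).2.1
  have hBj := (memE.1 hcd).2.1
  have : Nonempty V := ⟨a⟩
  choose! lo up hlo using fun e (he : e ∈ E) =>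
    hG.exists_lower_end b (e := e) (by simpa using (Finset.mem_filter.1 he).1)
  have hinj : Set.InjOn lo E := by
    intro e he e' he' h
    obtain ⟨h1, h2, h3⟩ := hlo e he
    obtain ⟨h1', h2', h3'⟩ := hlo e' he'
    rw [← h] at h1' h2' h3'
    rw [h1, h1', hG.eq_of_mem_branch h2 h2' h3 h3']
  have himg : E.image lo ⊆ (G.branch a b ∪ (G.branch c d).erase d)ᶜ := by
    intro x hx
    obtain ⟨e, he, rfl⟩ := Finset.mem_image.1 hx
    obtain ⟨h1, h2, h3⟩ := hlo e he
    have he' := h1 ▸ he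
    simp only [Finset.mem_compl, Finset.mem_union, Finset.mem_erase, not_or, not_and]
    refine ⟨fun hx => ?_, fun hne hx => ?_⟩
    · have := (eq_of_adj_of_mem_branch h2 hx (hA _ _ he' hx)).1
      exact hG.left_notMem_branch h2 (this ▸ h3)
    · exact hne (eq_of_adj_of_mem_branch h2 hx (hB _ _ he' hx)).1
  have h1 := Finset.card_le_card himg
  rw [Finset.card_image_of_injOn hinj, Finset.card_compl, Finset.card_union_of_disjoint,
    Finset.card_erase_of_mem (right_mem_branch c d)] at h1
  · have h2 : (G.branch a b).card + (G.branch c d).card ≤ Fintype.card V := by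
      rw [← Finset.card_union_of_disjoint hdisj.symm]
      exact Finset.card_le_univ _
    omega
  · exact (hdisj.mono_left (Finset.erase_subset _ _)).symm

end SimpleGraph

namespace SimpleGraph

variable {V : Type u} {G : SimpleGraph V}

/-! ### Recognizing paths and stars -/

lemma Connected.exists_adj_dist (hG : G.Connected) {b v : V} {k : ℕ} (h : G.dist b v = k + 1) :
    ∃ w, G.Adj v w ∧ G.dist b w = k := by
  obtain ⟨p, hp⟩ := hG.exists_walk_length_eq_dist v b
  rw [dist_comm, h] at hp
  cases p with
  | nil => simp at hp
  | @cons _ w _ hvw q =>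
    refine ⟨w, hvw, le_antisymm ?_ ?_⟩
    · rw [dist_comm]
      have := dist_le q
      simp only [Walk.length_cons] at hp
      omega
    · have h1 := hG.dist_triangle (u := b) (v := w) (w := v)
      have h2 : G.dist w v = 1 := dist_eq_one_iff_adj.2 hvw.symm
      omega

/-- A connected graph in which no vertex has three neighbours, and some vertex `b` has at most
one, is a path: the distance from `b` numbers its vertices. -/
lemma Connected.exists_iso_pathGraph [Fintype V] (hG : G.Connected) {b : V}
    (hb : ∀ u v, G.Adj b u → G.Adj b v → u = v)
    (h3 : ∀ x u v w, G.Adj x u → G.Adj x v → G.Adj x w → u = v ∨ u = w ∨ v = w) :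
    Nonempty (pathGraph (Fintype.card V) ≃g G) := by
  classical
  have hinj : ∀ k v w, G.dist b v = k → G.dist b w = k → v = w := by
    intro k
    induction k using Nat.strong_induction_on with
    | _ k ih =>
      intro v w hv hw
      rcases k with _ | k
      · rw [← hG.dist_eq_zero_iff.1 hv, ← hG.dist_eq_zero_iff.1 hw]
      · obtain ⟨v', hv', hdv⟩ := hG.exists_adj_dist hv
        obtain ⟨w', hw', hdw⟩ := hG.exists_adj_dist hw
        obtain rfl := ih k (by omega) v' w' hdv hdw
        rcases k with _ | k
        · obtain rfl := hG.dist_eq_zero_iff.1 hdv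
          exact hb _ _ hv'.symm hw'.symm
        · obtain ⟨x, hx, hdx⟩ := hG.exists_adj_dist hdv
          rcases h3 v' v w x hv'.symm hw'.symm hx with h | rfl | rfl
          · exact h
          · omega
          · omega
  have hdown : ∀ k v, G.dist b v = k → ∀ i ≤ k, ∃ w, G.dist b w = i := by
    intro k
    induction k with
    | zero => exact fun v hv i hi => ⟨v, by omega⟩
    | succ k ih =>
      intro v hv i hi
      rcases hi.eq_or_lt with rfl | hi
      · exact ⟨v, hv⟩
      · obtain ⟨w, _, hw⟩ := hG.exists_adj_dist hv
        exact ih w hw i (by omega)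
  have hlt : ∀ v, G.dist b v < Fintype.card V := by
    intro v
    have hsub : Finset.range (G.dist b v + 1) ⊆ Finset.univ.image (G.dist b) := by
      intro i hi
      obtain ⟨w, hw⟩ := hdown _ v rfl i (by simpa [Nat.lt_succ_iff] using hi)
      exact Finset.mem_image.2 ⟨w, Finset.mem_univ _, hw⟩
    have h1 := Finset.card_le_card hsub
    have h2 : (Finset.univ.image (G.dist b)).card ≤ Fintype.card V := Finset.card_image_le
    rw [Finset.card_range] at h1
    omega
  let f : V → Fin (Fintype.card V) := fun v => ⟨G.dist b v, hlt v⟩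
  have hf : Function.Bijective f := by
    rw [Fintype.bijective_iff_injective_and_card]
    exact ⟨fun v w h => hinj _ v w rfl (Fin.mk.inj_iff.1 h).symm, by simp⟩
  have hcons : ∀ v w, G.dist b v + 1 = G.dist b w → G.Adj v w := by
    intro v w h
    obtain ⟨x, hx, hdx⟩ := hG.exists_adj_dist h.symm
    rw [hinj _ v x rfl hdx]
    exact hx.symm
  refine ⟨RelIso.symm ⟨Equiv.ofBijective f hf, ?_⟩⟩
  intro v w
  simp only [Equiv.ofBijective_apply, pathGraph_adj, f]
  constructor
  · rintro (h | h)
    · exact hcons v w h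
    · exact (hcons w v h).symm
  · intro h
    have h1 := hG.dist_triangle (u := b) (v := v) (w := w)
    have h2 := hG.dist_triangle (u := b) (v := w) (w := v)
    rw [dist_eq_one_iff_adj.2 h] at h1
    rw [dist_eq_one_iff_adj.2 h.symm] at h2
    have h3 : G.dist b v ≠ G.dist b w := fun h' => h.ne (hinj _ v w rfl h'.symm)
    omega

variable [Fintype V]

/-- Every branch of a tree contains a leaf of the tree. -/
lemma IsTree.exists_leaf (hG : G.IsTree) {x z : V} (hz : G.Adj x z) :
    ∃ p q, G.Adj p q ∧ G.branch p q = {q} ∧ q ∈ G.branch x z := by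
  classical
  obtain ⟨⟨p, q⟩, hpq, hmin⟩ := (Finset.univ.filter fun p : V × V =>
    G.Adj p.1 p.2 ∧ G.branch p.1 p.2 ⊆ G.branch x z).exists_min_image
      (fun p => (G.branch p.1 p.2).card) ⟨(x, z), by simp [hz]⟩
  simp only [Finset.mem_filter, Finset.mem_univ, true_and] at hpq hmin
  refine ⟨p, q, hpq.1, ?_, hpq.2 (right_mem_branch p q)⟩
  by_contra hne
  obtain ⟨v, hv, hvq⟩ : ∃ v ∈ G.branch p q, v ≠ q := by
    by_contra! h
    exact hne (Finset.eq_singleton_iff_unique_mem.2 ⟨right_mem_branch p q, h⟩)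
  obtain ⟨r, hqr, hvr⟩ := hG.exists_mem_branch hvq
  have hrp : r ≠ p := by
    rintro rfl
    exact (hG.mem_branch_swap hpq.1 v).1 hvr hv
  have hr : r ∈ G.branch p q := by
    by_contra hr
    exact hrp (eq_of_adj_of_mem_branch hqr (right_mem_branch p q) hr).2
  have hp : p ∉ G.branch q r := fun hp =>
    hrp (hG.eq_of_mem_branch hqr hpq.1.symm hp (right_mem_branch q p))
  have hss := hG.branch_ssubset hqr (right_mem_branch p q) hr hp
  exact (Finset.card_lt_card hss).not_ge (hmin (q, r) ⟨hqr, hss.subset.trans hpq.2⟩)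

open Classical in
/-- A tree with at most two leaves is a path. On at most three vertices, the hypothesis on the
number of leaves is not needed. -/
lemma IsTree.exists_iso_pathGraph (hG : G.IsTree)
    (h : 4 ≤ Fintype.card V → (G.edgeFinset.filter fun e => G.edgeBalance e = 1).card ≤ 2) :
    Nonempty (pathGraph (Fintype.card V) ≃g G) := by
  have hne : ∀ {x z z' p q p' q'}, G.Adj x z → G.Adj x z' → z ≠ z' → G.Adj p q → G.Adj p' q' →
      G.branch p q = {q} → q ∈ G.branch x z → G.branch p' q' = {q'} → q' ∈ G.branch x z' →
      s(p, q) ≠ s(p', q') := by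
    intro x z z' p q p' q' hz hz' hzz hpq hpq' hb hq hb' hq' he
    rcases Sym2.eq_iff.1 he with ⟨rfl, rfl⟩ | ⟨rfl, rfl⟩
    · exact hzz (hG.eq_of_mem_branch hz hz' hq hq')
    · by_cases hx : x ∈ G.branch p q
      · rw [hb, Finset.mem_singleton] at hx
        subst hx
        exact hG.left_notMem_branch hz hq
      · rw [← hG.mem_branch_swap hpq, hb', Finset.mem_singleton] at hx
        subst hx
        exact hG.left_notMem_branch hz' hq'
  have h3 : ∀ x u v w, G.Adj x u → G.Adj x v → G.Adj x w → u = v ∨ u = w ∨ v = w := by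
    intro x u v w hu hv hw
    by_contra! hcon
    obtain ⟨huv, huw, hvw⟩ := hcon
    have h4 : 4 ≤ Fintype.card V := by
      have : ({x, u, v, w} : Finset V).card = 4 := by
        rw [Finset.card_insert_of_notMem, Finset.card_insert_of_notMem,
          Finset.card_pair hvw] <;> simp [*, hu.ne, hv.ne, hw.ne]
      rw [← this]
      exact Finset.card_le_univ _
    obtain ⟨p, q, hpq, hb, hq⟩ := hG.exists_leaf hu
    obtain ⟨p', q', hpq', hb', hq'⟩ := hG.exists_leaf hv
    obtain ⟨p'', q'', hpq'', hb'', hq''⟩ := hG.exists_leaf hw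
    have e1 := hne hu hv huv hpq hpq' hb hq hb' hq'
    have e2 := hne hu hw huw hpq hpq'' hb hq hb'' hq''
    have e3 := hne hv hw hvw hpq' hpq'' hb' hq' hb'' hq''
    have hmem : ∀ {p q}, G.Adj p q → G.branch p q = {q} →
        s(p, q) ∈ G.edgeFinset.filter fun e => G.edgeBalance e = 1 := by
      intro p q hpq hb
      have := card_branch_pos (G := G) q p
      simp only [Finset.mem_filter, mem_edgeFinset, mem_edgeSet, edgeBalance_mk, hb,
        Finset.card_singleton]
      exact ⟨hpq, by omega⟩
    have hsub : ({s(p, q), s(p', q'), s(p'', q'')} : Finset (Sym2 V)) ⊆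
        G.edgeFinset.filter fun e => G.edgeBalance e = 1 := by
      intro e he
      simp only [Finset.mem_insert, Finset.mem_singleton] at he
      rcases he with rfl | rfl | rfl
      exacts [hmem hpq hb, hmem hpq' hb', hmem hpq'' hb'']
    have := (Finset.card_le_card hsub).trans (h h4)
    rw [Finset.card_insert_of_notMem (by simp [e1, e2]), Finset.card_pair e3] at this
    omega
  obtain ⟨b, hb⟩ : ∃ b, ∀ u v, G.Adj b u → G.Adj b v → u = v := by
    have := hG.connected.nonempty
    obtain ⟨x⟩ := this
    by_cases hx : ∃ z, G.Adj x z
    · obtain ⟨z, hz⟩ := hx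
      obtain ⟨p, q, hpq, hb, -⟩ := hG.exists_leaf hz
      have : ∀ r, G.Adj q r → r = p := by
        intro r hr
        exact (eq_of_adj_of_mem_branch hr (right_mem_branch p q)
          (by simp [hb, hr.ne.symm])).2
      exact ⟨q, fun u v hu hv => (this u hu).trans (this v hv).symm⟩
    · exact ⟨x, fun u _ hu => (hx ⟨u, hu⟩).elim⟩
  exact hG.connected.exists_iso_pathGraph hb h3

/-- The sides of the edges of a path. -/
lemma IsTree.card_branch_of_iso_pathGraph (hG : G.IsTree)
    (p : pathGraph (Fintype.card V) ≃g G) {i : ℕ} (hi : i + 1 < Fintype.card V) :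
    (G.branch (p ⟨i, by omega⟩) (p ⟨i + 1, hi⟩)).card = Fintype.card V - (i + 1) := by
  classical
  have hadj : G.Adj (p ⟨i, by omega⟩) (p ⟨i + 1, hi⟩) := by
    rw [p.map_adj_iff, pathGraph_adj]
    exact Or.inl rfl
  have hU : G.branch (p ⟨i, by omega⟩) (p ⟨i + 1, hi⟩) =
      (Finset.Ioi (⟨i, by omega⟩ : Fin (Fintype.card V))).map p.toEquiv.toEmbedding := by
    have hmem : ∀ k, p k ∈ (Finset.Ioi (⟨i, by omega⟩ : Fin (Fintype.card V))).map
        p.toEquiv.toEmbedding ↔ i < k.1 := by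
      intro k
      rw [Finset.mem_map]
      constructor
      · rintro ⟨l, hl, hlk⟩
        obtain rfl : l = k := p.injective hlk
        simpa [Fin.lt_def] using hl
      · intro hk
        exact ⟨k, by simpa [Fin.lt_def] using hk, rfl⟩
    refine hG.branch_eq hadj ?_ ?_ ?_
    · rw [hmem]
      simp
    · rw [hmem]
      simp
    · intro v w hvw hv hw
      obtain ⟨k, rfl⟩ := p.surjective v
      obtain ⟨l, rfl⟩ := p.surjective w
      rw [hmem] at hv hw
      rw [p.map_adj_iff, pathGraph_adj] at hvw
      have h1 : k = ⟨i + 1, hi⟩ := Fin.ext (by simp; omega)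
      have h2 : l = ⟨i, by omega⟩ := Fin.ext (by simp; omega)
      rw [h1, h2]
      exact ⟨rfl, rfl⟩
  rw [hU, Finset.card_map, Fin.card_Ioi]
  simp
  omega

lemma IsTree.edgeBalance_of_iso_pathGraph (hG : G.IsTree)
    (p : pathGraph (Fintype.card V) ≃g G) {i : ℕ} (hi : i + 1 < Fintype.card V) :
    G.edgeBalance s(p ⟨i, by omega⟩, p ⟨i + 1, hi⟩) = min (i + 1) (Fintype.card V - (i + 1)) := by
  have hadj : G.Adj (p ⟨i, by omega⟩) (p ⟨i + 1, hi⟩) := by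
    rw [p.map_adj_iff, pathGraph_adj]
    exact Or.inl rfl
  have h1 := hG.card_branch_of_iso_pathGraph p hi
  have h2 := hG.card_branch_add hadj
  rw [edgeBalance_mk]
  omega

lemma exists_edge_eq_of_iso_pathGraph (p : pathGraph (Fintype.card V) ≃g G) {e : Sym2 V}
    (he : e ∈ G.edgeSet) :
    ∃ (i : ℕ) (hi : i + 1 < Fintype.card V), e = s(p ⟨i, by omega⟩, p ⟨i + 1, hi⟩) := by
  induction e using Sym2.ind with
  | _ x y =>
    obtain ⟨⟨k, hk⟩, rfl⟩ := p.surjective x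
    obtain ⟨⟨l, hl⟩, rfl⟩ := p.surjective y
    rw [mem_edgeSet, p.map_adj_iff, pathGraph_adj] at he
    simp only at he
    rcases he with rfl | rfl
    · exact ⟨k, hl, rfl⟩
    · exact ⟨l, hk, Sym2.eq_swap⟩

open Classical in
/-- In a path, the bound of `IsTree.card_le_edgeBalance` is attained. -/
lemma IsTree.card_le_edgeBalance_of_iso_pathGraph (hG : G.IsTree)
    (p : pathGraph (Fintype.card V) ≃g G) {j : ℕ} (hj : 1 ≤ j) (hj' : 2 * j ≤ Fintype.card V) :
    (G.edgeFinset.filter fun e => j ≤ G.edgeBalance e).card + 2 * j = Fintype.card V + 1 := by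
  refine le_antisymm (hG.card_le_edgeBalance hj') ?_
  have hadj : ∀ (i : ℕ) (hi : i + 1 < Fintype.card V),
      G.Adj (p ⟨i, by omega⟩) (p ⟨i + 1, hi⟩) := by
    intro i hi
    rw [p.map_adj_iff, pathGraph_adj]
    exact Or.inl rfl
  let f : Fin (Fintype.card V + 1 - 2 * j) → Sym2 V := fun i =>
    s(p ⟨i.1 + j - 1, by omega⟩, p ⟨i.1 + j - 1 + 1, by omega⟩)
  have hf : Function.Injective f := by
    intro i k h
    rcases Sym2.eq_iff.1 h with ⟨h1, -⟩ | ⟨h1, h2⟩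
    · have := Fin.mk.inj_iff.1 (p.injective h1)
      ext
      omega
    · have h1 := Fin.mk.inj_iff.1 (p.injective h1)
      have h2 := Fin.mk.inj_iff.1 (p.injective h2)
      omega
  have hsub : Finset.univ.image f ⊆ G.edgeFinset.filter fun e => j ≤ G.edgeBalance e := by
    intro e he
    obtain ⟨i, -, rfl⟩ := Finset.mem_image.1 he
    rw [Finset.mem_filter, mem_edgeFinset]
    refine ⟨hadj _ _, ?_⟩
    simp only [f]
    rw [hG.edgeBalance_of_iso_pathGraph p (by omega)]
    omega
  have := Finset.card_le_card hsub
  rw [Finset.card_image_of_injective _ hf, Finset.card_univ, Fintype.card_fin] at this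
  omega

/-- A tree all of whose edges are pendant is a star. -/
lemma IsTree.exists_center (hG : G.IsTree) (h : ∀ e ∈ G.edgeSet, G.edgeBalance e = 1) :
    ∃ z, ∀ x y, G.Adj x y ↔ x ≠ y ∧ (x = z ∨ y = z) := by
  obtain ⟨x⟩ := hG.connected.nonempty
  by_cases hx : ∃ z, G.Adj x z
  · obtain ⟨z, hz⟩ := hx
    obtain ⟨c, l, hcl, hb, -⟩ := hG.exists_leaf hz
    have hbr : ∀ a, G.Adj c a → G.branch c a = {a} := by
      intro a ha
      by_cases hal : a = l
      · rw [hal, hb]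
      have h1 := h s(c, a) ha
      rw [edgeBalance_mk] at h1
      have h2 : 1 < (G.branch a c).card := by
        refine Finset.one_lt_card.2 ⟨c, right_mem_branch a c, l, ?_, hcl.ne⟩
        rw [hG.mem_branch_swap ha]
        exact fun hl => hal (hG.eq_of_mem_branch ha hcl hl (right_mem_branch c l))
      have h3 : (G.branch c a).card = 1 := by omega
      obtain ⟨v, hv⟩ := Finset.card_eq_one.1 h3
      have := right_mem_branch (G := G) c a
      rw [hv, Finset.mem_singleton] at this
      rw [hv, this]
    have hadj : ∀ v, v ≠ c → G.Adj c v := by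
      intro v hv
      obtain ⟨a, ha, hva⟩ := hG.exists_mem_branch hv
      rw [hbr a ha, Finset.mem_singleton] at hva
      rwa [hva]
    refine ⟨c, fun x y => ⟨fun hxy => ⟨hxy.ne, ?_⟩, ?_⟩⟩
    · by_contra! hc
      have := eq_of_adj_of_mem_branch hxy (right_mem_branch c x)
        (by simp [hbr x (hadj x hc.1), hxy.ne.symm])
      exact hc.2 this.2
    · rintro ⟨hne, rfl | rfl⟩
      · exact hadj y hne.symm
      · exact (hadj x hne).symm
  · have hsub : ∀ y, y = x :=
      hG.connected.forall_of_adj (P := fun y => y = x)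
        (fun p q hpq hp => (hx ⟨q, hp ▸ hpq⟩).elim) rfl
    exact ⟨x, fun a b => ⟨fun hab => absurd ((hsub a).trans (hsub b).symm) hab.ne,
      fun hab => absurd ((hsub a).trans (hsub b).symm) hab.1⟩⟩

lemma IsTree.edgeBalance_of_center (hG : G.IsTree) {z : V}
    (hz : ∀ x y, G.Adj x y → x = z ∨ y = z) {e : Sym2 V} (he : e ∈ G.edgeSet) :
    G.edgeBalance e = 1 := by
  have key : ∀ y, G.Adj z y → G.edgeBalance s(z, y) = 1 := by
    intro y hy
    have : G.branch z y = {y} := by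
      refine hG.branch_eq hy (by simp [hy.ne]) (by simp) ?_
      intro p q hpq hp hq
      obtain rfl := Finset.mem_singleton.1 hp
      exact ⟨rfl, (hz p q hpq).resolve_left hy.ne.symm⟩
    have h2 := card_branch_pos (G := G) y z
    rw [edgeBalance_mk, this, Finset.card_singleton]
    omega
  induction e using Sym2.ind with
  | _ x y =>
    rcases hz x y he with rfl | rfl
    · exact key y he
    · rw [Sym2.eq_swap]
      exact key x (Adj.symm he)

end SimpleGraph

namespace WeightedGraph

/-! ### Hitting times as solutions of the first-step equations -/

section RandomWalk

variable {V : Type u}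

/-- The trajectories that have not visited `y` up to time `t`. -/
def avoid (y : V) (t : ℕ) : Set (ℕ → V) := {X | ∀ s ≤ t, X s ≠ y}

lemma firstHit_eq_tsum (y : V) (X : ℕ → V) :
    firstHit y X = ∑' t, (avoid y t).indicator (fun _ => (1 : ℝ≥0∞)) X := by
  classical
  by_cases h : ∃ t, X t = y
  · have hlt : ∀ t, X ∈ avoid y t ↔ t < Nat.find h := by
      intro t
      rw [Nat.lt_find_iff]
      rfl
    rw [tsum_eq_sum (s := Finset.range (Nat.find h))]
    · rw [Finset.sum_congr rfl (g := fun _ => (1 : ℝ≥0∞))]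
      · simp only [Finset.sum_const, Finset.card_range, nsmul_eq_mul, mul_one]
        refine le_antisymm
          (iInf₂_le (f := fun (t : ℕ) (_ : X t = y) => (t : ℝ≥0∞)) _ (Nat.find_spec h))
          (le_iInf₂ fun t ht => ?_)
        exact_mod_cast Nat.find_min' h ht
      · intro t ht
        exact Set.indicator_of_mem ((hlt t).2 (Finset.mem_range.1 ht)) _
    · intro t ht
      exact Set.indicator_of_notMem (fun h' => ht (Finset.mem_range.2 ((hlt t).1 h'))) _
  · push Not at h
    have h1 : ∀ t, X ∈ avoid y t := fun t s _ => h s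
    simp [firstHit, h, h1]

lemma measurableSet_avoid [MeasurableSpace V] [DiscreteMeasurableSpace V] (y : V) (t : ℕ) :
    MeasurableSet (avoid y t) := by
  have : avoid y t = ⋂ s, ⋂ (_ : s ≤ t), (fun X : ℕ → V => X s) ⁻¹' {y}ᶜ := by
    ext X
    simp [avoid]
  rw [this]
  exact MeasurableSet.iInter fun s => MeasurableSet.iInter fun _ =>
    measurable_pi_apply s (MeasurableSet.of_discrete)

variable [Fintype V] [MeasurableSpace V] [DiscreteMeasurableSpace V] (G : WeightedGraph V)

instance (x : V) : IsProbabilityMeasure (G.walkLaw x) := by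
  unfold walkLaw
  infer_instance

/-- The Markov property at time `t`, on the event that `y` has not been visited yet. -/
lemma lintegral_avoid_succ (x y : V) (t : ℕ) (f : V → ℝ≥0∞) :
    ∫⁻ X, (avoid y t).indicator (fun X => f (X (t + 1))) X ∂(G.walkLaw x) =
      ∫⁻ X, (avoid y t).indicator (fun X => ∫⁻ z, f z ∂(G.stepMeasure (X t))) X
        ∂(G.walkLaw x) := by
  have hf : Measurable f := Measurable.of_discrete
  let S : Set (Finset.Iic t → V) := {h | ∀ s, h s ≠ y}
  have hS : MeasurableSet S := by
    have : S = ⋂ s, (fun h : Finset.Iic t → V => h s) ⁻¹' {y}ᶜ := by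
      ext X
      simp [S]
    rw [this]
    exact MeasurableSet.iInter fun s => measurable_pi_apply s (MeasurableSet.of_discrete)
  have hSa : ∀ X : ℕ → V, Preorder.frestrictLe (π := fun _ => V) t X ∈ S ↔ X ∈ avoid y t := by
    intro X
    simp [S, avoid]
  let F : (Finset.Iic t → V) × V → ℝ≥0∞ := fun p => S.indicator (fun _ => f p.2) p.1
  have hF : Measurable F := by
    have : F = (Prod.fst ⁻¹' S).indicator (fun p => f p.2) := by
      ext p
      rfl
    rw [this]
    exact (hf.comp measurable_snd).indicator (measurable_fst hS)
  have key := Kernel.partialTraj_compProd_eq_map_traj (X := fun _ => V) (κ := G.historyKernel)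
    (a := 0) (b := t) (Nat.zero_le t) (x₀ := fun _ => x)
  have h1 : ∫⁻ X, (avoid y t).indicator (fun X => f (X (t + 1))) X ∂(G.walkLaw x) =
      ∫⁻ p, F p ∂((Kernel.traj (X := fun _ => V) G.historyKernel 0 (fun _ => x)).map
        (fun X => (Preorder.frestrictLe (π := fun _ => V) t X, X (t + 1)))) := by
    rw [lintegral_map hF (by fun_prop)]
    refine lintegral_congr fun X => ?_
    by_cases hX : X ∈ avoid y t
    · simp only [F, Set.indicator_of_mem ((hSa X).2 hX), Set.indicator_of_mem hX]
    · simp only [F, Set.indicator_of_notMem (fun h => hX ((hSa X).1 h)),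
        Set.indicator_of_notMem hX]
  have h2 : Measurable fun h : Finset.Iic t → V => ∫⁻ z, F (h, z) ∂(G.historyKernel t h) :=
    hF.lintegral_kernel_prod_right'
  rw [h1, ← key, Measure.lintegral_compProd hF,
    ← Kernel.traj_map_frestrictLe_apply, lintegral_map h2 (by fun_prop)]
  refine lintegral_congr fun X => ?_
  by_cases hX : X ∈ avoid y t
  · simp only [F, Set.indicator_of_mem ((hSa X).2 hX), Set.indicator_of_mem hX]
    rfl
  · have hX' : Preorder.frestrictLe (π := fun _ => V) t X ∉ S := fun h => hX ((hSa X).1 h)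
    simp [F, Set.indicator_of_notMem hX', Set.indicator_of_notMem hX]

lemma lintegral_walkLaw_zero (x : V) {f : V → ℝ≥0∞} :
    ∫⁻ X, f (X 0) ∂(G.walkLaw x) = f x := by
  have hf : Measurable f := Measurable.of_discrete
  unfold walkLaw
  rw [Kernel.lintegral_traj (X := fun _ => V) _ (f := fun X : ℕ → V => f (X 0))
    (hf.comp (measurable_pi_apply 0))]
  simp [Function.updateFinset]

/-- A finite solution `H` of the first-step equations with target `y` is the vector of the hitting
times of `y`. Stopped at the first visit of `y`, the process `t + H (X t)` is a martingale; the
finiteness of `H` bounds the expected hitting time, and therefore the part of `H (X t)` on the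
event that `y` has not been visited by time `t` tends to `0`. -/
lemma lintegral_firstHit_eq {y : V} {H : V → ℝ≥0∞} (hy : H y = 0) (hH : ∀ x, H x ≠ ∞)
    (hstep : ∀ x, x ≠ y → H x = 1 + ∫⁻ z, H z ∂(G.stepMeasure x)) (x : V) :
    ∫⁻ X, firstHit y X ∂(G.walkLaw x) = H x := by
  set P := G.walkLaw x with hP
  have hHm : Measurable H := Measurable.of_discrete
  have hsucc : ∀ t, ∫⁻ X, (avoid y t).indicator (fun X => H (X t)) X ∂P =
      P (avoid y t) + ∫⁻ X, (avoid y (t + 1)).indicator (fun X => H (X (t + 1))) X ∂P := by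
    intro t
    have h1 : ∀ X : ℕ → V, (avoid y (t + 1)).indicator (fun X => H (X (t + 1))) X =
        (avoid y t).indicator (fun X => H (X (t + 1))) X := by
      intro X
      by_cases h : X (t + 1) = y
      · simp [Set.indicator, h, hy]
      · have : X ∈ avoid y (t + 1) ↔ X ∈ avoid y t := by
          simp only [avoid, Set.mem_ofPred_eq]
          refine ⟨fun h' s hs => h' s (by omega), fun h' s hs => ?_⟩
          rcases hs.eq_or_lt with rfl | hs
          · exact h
          · exact h' s (by omega)
        by_cases hX : X ∈ avoid y t
        · rw [Set.indicator_of_mem hX, Set.indicator_of_mem (this.2 hX)]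
        · rw [Set.indicator_of_notMem hX, Set.indicator_of_notMem (fun h => hX (this.1 h))]
    simp_rw [h1]
    rw [hP, G.lintegral_avoid_succ, ← lintegral_indicator_one (measurableSet_avoid y t),
      ← lintegral_add_left (measurable_one.indicator (measurableSet_avoid y t))]
    refine lintegral_congr fun X => ?_
    by_cases hX : X ∈ avoid y t
    · simp only [Set.indicator_of_mem hX]
      exact hstep _ (hX t le_rfl)
    · simp [Set.indicator_of_notMem hX]
  have hzero : ∫⁻ X, (avoid y 0).indicator (fun X => H (X 0)) X ∂P = H x := by
    rw [hP, ← G.lintegral_walkLaw_zero x (f := H)]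
    refine lintegral_congr fun X => ?_
    by_cases h : X 0 = y
    · simp [Set.indicator, h, hy]
    · refine Set.indicator_of_mem (fun s hs => ?_) _
      rwa [Nat.le_zero.1 hs]
  have hsum : ∀ t, ∑ s ∈ Finset.range t, P (avoid y s) +
      ∫⁻ X, (avoid y t).indicator (fun X => H (X t)) X ∂P = H x := by
    intro t
    induction t with
    | zero => simpa using hzero
    | succ t ih => rw [Finset.sum_range_succ, add_assoc, ← hsucc, ih]
  have hlim := ENNReal.summable.hasSum.tendsto_sum_nat (f := fun s => P (avoid y s))
  have hle : ∑' s, P (avoid y s) ≤ H x :=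
    le_of_tendsto' hlim fun t => (le_self_add).trans (hsum t).le
  have hzero' : Filter.Tendsto (fun t => P (avoid y t)) Filter.atTop (nhds 0) :=
    ENNReal.tendsto_atTop_zero_of_tsum_ne_top (ne_top_of_le_ne_top (hH x) hle)
  have hC : ∑ v, H v ≠ ∞ := by simp [hH]
  have hrest : Filter.Tendsto (fun t => ∫⁻ X, (avoid y t).indicator (fun X => H (X t)) X ∂P)
      Filter.atTop (nhds 0) := by
    have h1 : Filter.Tendsto (fun t => (∑ v, H v) * P (avoid y t)) Filter.atTop (nhds 0) := by
      simpa using ENNReal.Tendsto.const_mul hzero' (Or.inr hC)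
    refine tendsto_of_tendsto_of_tendsto_of_le_of_le tendsto_const_nhds h1 (fun _ => zero_le)
      fun t => ?_
    simp only
    rw [← lintegral_indicator_const (measurableSet_avoid y t)]
    refine lintegral_mono fun X => Set.indicator_le_indicator ?_
    exact Finset.single_le_sum (f := H) (fun _ _ => zero_le) (Finset.mem_univ (X t))
  have hlim' := hlim.add hrest
  simp_rw [hsum, add_zero] at hlim'
  rw [tendsto_nhds_unique tendsto_const_nhds hlim']
  simp_rw [firstHit_eq_tsum]
  rw [lintegral_tsum fun t =>
    ((measurable_const).indicator (measurableSet_avoid y t)).aemeasurable]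
  refine tsum_congr fun t => ?_
  exact lintegral_indicator_one (measurableSet_avoid y t)

end RandomWalk

end WeightedGraph

/-! ### The average hitting time of a tree -/

namespace SimpleGraph

open Classical in
lemma sum_adj_eq_two_mul_sum_edgeFinset {V : Type u} [Fintype V] (G : SimpleGraph V)
    (F : Sym2 V → ℝ) :
    ∑ a, ∑ b, (if G.Adj a b then F s(a, b) else 0) = 2 * ∑ e ∈ G.edgeFinset, F e := by
  rw [← Finset.sum_product', Finset.univ_product_univ, ← Finset.sum_filter,
    ← Finset.sum_fiberwise_of_maps_to (g := fun p : V × V => s(p.1, p.2)) (t := G.edgeFinset)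
      (fun p hp => by simpa using hp), Finset.mul_sum]
  refine Finset.sum_congr rfl fun e he => ?_
  induction e using Sym2.ind with
  | _ a b =>
    have hab : G.Adj a b := by simpa using he
    have : (Finset.univ.filter fun p : V × V => G.Adj p.1 p.2).filter
        (fun p => s(p.1, p.2) = s(a, b)) = {(a, b), (b, a)} := by
      ext ⟨c, d⟩
      simp only [Finset.mem_filter, Finset.mem_univ, true_and, Sym2.eq_iff, Finset.mem_insert,
        Finset.mem_singleton, Prod.mk.injEq]
      constructor
      · exact fun h => h.2
      · rintro (⟨rfl, rfl⟩ | ⟨rfl, rfl⟩)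
        · exact ⟨hab, Or.inl ⟨rfl, rfl⟩⟩
        · exact ⟨hab.symm, Or.inr ⟨rfl, rfl⟩⟩
    rw [this, Finset.sum_pair (by simp [hab.ne])]
    simp only [Sym2.eq_swap (a := b)]
    ring

end SimpleGraph

namespace WeightedGraph

variable {V : Type u} [Fintype V] (G : WeightedGraph V)

open Classical in
/-- The closed formula for the hitting times of a tree: every edge `ab` on the path from `u` to
`y`, crossed from `a` to `b`, contributes the total degree of the side of `a` divided by the
weight of the edge. -/
noncomputable def treeHit (u y : V) : ℝ :=
  ∑ a, ∑ b, if G.graph.Adj a b ∧ u ∉ G.graph.branch a b ∧ y ∈ G.graph.branch a b then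
    (∑ v ∈ G.graph.branch b a, G.degree v) / G.weight s(a, b) else 0

variable {G}

lemma treeHit_nonneg (u y : V) : 0 ≤ G.treeHit u y := by
  unfold treeHit
  refine Finset.sum_nonneg fun a _ => Finset.sum_nonneg fun b _ => ?_
  split_ifs
  · exact div_nonneg (Finset.sum_nonneg fun v _ => G.degree_nonneg v) (G.weight_nonneg _)
  · exact le_rfl

lemma treeHit_self (y : V) : G.treeHit y y = 0 := by
  unfold treeHit
  refine Finset.sum_eq_zero fun a _ => Finset.sum_eq_zero fun b _ => if_neg ?_
  tauto

open Classical in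
/-- Only the edge `xz` distinguishes the formulas for two adjacent starting points `x` and `z`. -/
lemma weight_mul_treeHit_sub (hG : G.graph.IsTree) {x z : V} (hxz : G.graph.Adj x z) (y : V) :
    G.weight s(x, z) * (G.treeHit x y - G.treeHit z y) =
      (if y ∈ G.graph.branch x z then ∑ v, G.degree v else 0) -
        ∑ v ∈ G.graph.branch x z, G.degree v := by
  have hw : G.weight s(x, z) ≠ 0 := (G.weight_pos _ hxz).ne'
  have hx := hG.left_notMem_branch hxz
  have hz := hG.left_notMem_branch hxz.symm
  have hterm : ∀ a b : V,
      ((if G.graph.Adj a b ∧ x ∉ G.graph.branch a b ∧ y ∈ G.graph.branch a b then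
        (∑ v ∈ G.graph.branch b a, G.degree v) / G.weight s(a, b) else 0) -
      (if G.graph.Adj a b ∧ z ∉ G.graph.branch a b ∧ y ∈ G.graph.branch a b then
        (∑ v ∈ G.graph.branch b a, G.degree v) / G.weight s(a, b) else 0)) =
      (if a = x then (if b = z then (if y ∈ G.graph.branch x z then
        (∑ v ∈ G.graph.branch z x, G.degree v) / G.weight s(x, z) else 0) else 0) else 0) -
      (if a = z then (if b = x then (if y ∈ G.graph.branch x z then 0 else
        (∑ v ∈ G.graph.branch x z, G.degree v) / G.weight s(x, z)) else 0) else 0) := by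
    intro a b
    by_cases h1 : a = x ∧ b = z
    · obtain ⟨rfl, rfl⟩ := h1
      simp [hxz, hx, hxz.ne, SimpleGraph.right_mem_branch]
    by_cases h2 : a = z ∧ b = x
    · obtain ⟨rfl, rfl⟩ := h2
      have h3 : s(a, b) = s(b, a) := Sym2.eq_swap
      by_cases hy : y ∈ G.graph.branch b a <;>
        simp [hxz.symm, hz, hx, hxz.ne.symm, h3, hG.mem_branch_swap hxz, hy]
    have h3 : (x ∉ G.graph.branch a b) ↔ (z ∉ G.graph.branch a b) := by
      rw [not_iff_not]
      constructor
      · intro h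
        by_contra h'
        have := SimpleGraph.eq_of_adj_of_mem_branch hxz h h'
        exact h2 ⟨this.2.symm, this.1.symm⟩
      · intro h
        by_contra h'
        have := SimpleGraph.eq_of_adj_of_mem_branch hxz.symm h h'
        exact h1 ⟨this.2.symm, this.1.symm⟩
    simp only [h3, sub_self]
    by_cases hax : a = x <;> by_cases haz : a = z <;> simp_all
  have hsub : G.treeHit x y - G.treeHit z y =
      (if y ∈ G.graph.branch x z then
        (∑ v ∈ G.graph.branch z x, G.degree v) / G.weight s(x, z) else 0) -
      (if y ∈ G.graph.branch x z then 0 else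
        (∑ v ∈ G.graph.branch x z, G.degree v) / G.weight s(x, z)) := by
    unfold treeHit
    simp only [← Finset.sum_sub_distrib, hterm]
    simp only [Finset.sum_sub_distrib, Finset.sum_ite_eq', Finset.mem_univ, if_true,
      Finset.sum_ite_irrel, Finset.sum_const_zero]
  have hsplit : ∑ v, G.degree v = ∑ v ∈ G.graph.branch x z, G.degree v +
      ∑ v ∈ G.graph.branch z x, G.degree v := by
    rw [hG.branch_swap hxz, Finset.sum_add_sum_compl]
  rw [hsub]
  split_ifs
  · field_simp
    rw [hsplit]
    ring
  · field_simp
    ring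

open Classical in
lemma sum_mem_branch_eq_one (hG : G.graph.IsTree) {x v : V} (hv : v ≠ x) (c : ℝ) :
    (∑ z, if G.graph.Adj x z ∧ v ∈ G.graph.branch x z then c else 0) = c := by
  obtain ⟨z, hz, hvz⟩ := hG.exists_mem_branch hv
  rw [Finset.sum_eq_single z]
  · simp [hz, hvz]
  · intro z' _ hne
    exact if_neg fun h => hne (hG.eq_of_mem_branch h.1 hz h.2 hvz)
  · simp

open Classical in
lemma sum_adj_eq_sum_weight (x : V) (f : V → ℝ) :
    ∑ z, G.weight s(x, z) * f z =
      ∑ z, if G.graph.Adj x z then G.weight s(x, z) * f z else 0 := by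
  refine Finset.sum_congr rfl fun z _ => ?_
  split_ifs with h
  · rfl
  · rw [G.weight_eq_zero _ h, zero_mul]

/-- The first-step equations of `treeHit`, as an equation for the Laplacian. -/
lemma sum_weight_mul_treeHit_sub (hG : G.graph.IsTree) {x y : V} (hxy : x ≠ y) :
    ∑ z, G.weight s(x, z) * (G.treeHit x y - G.treeHit z y) = G.degree x := by
  classical
  rw [sum_adj_eq_sum_weight]
  have h1 : ∀ z, (if G.graph.Adj x z then
      G.weight s(x, z) * (G.treeHit x y - G.treeHit z y) else 0) =
      (if G.graph.Adj x z ∧ y ∈ G.graph.branch x z then ∑ v, G.degree v else 0) -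
      ∑ v, (if G.graph.Adj x z ∧ v ∈ G.graph.branch x z then G.degree v else 0) := by
    intro z
    by_cases h : G.graph.Adj x z
    · simp only [h, if_true, true_and, weight_mul_treeHit_sub hG h]
      congr 1
      rw [← Finset.sum_filter, Finset.filter_univ_mem]
    · simp [h]
  simp only [h1]
  rw [Finset.sum_sub_distrib, sum_mem_branch_eq_one hG hxy.symm, Finset.sum_comm,
    ← Finset.sum_sub_distrib, Finset.sum_eq_single x]
  · rw [sub_eq_self]
    exact Finset.sum_eq_zero fun z _ => if_neg fun h => hG.left_notMem_branch h.1 h.2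
  · intro v _ hv
    rw [sum_mem_branch_eq_one hG hv, sub_self]
  · simp

lemma degree_pos_of_ne (hG : G.graph.IsTree) {x y : V} (hxy : x ≠ y) : 0 < G.degree x := by
  obtain ⟨z, hz, -⟩ := hG.exists_mem_branch hxy.symm
  exact Finset.sum_pos' (fun _ _ => G.weight_nonneg _) ⟨z, Finset.mem_univ _, G.weight_pos _ hz⟩

lemma hittingTime_eq (hG : G.graph.IsTree) (x y : V) :
    G.hittingTime x y = ENNReal.ofReal (G.treeHit x y) := by
  unfold hittingTime
  let _ : MeasurableSpace V := ⊤
  refine G.lintegral_firstHit_eq (H := fun x => ENNReal.ofReal (G.treeHit x y))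
    (by simp [treeHit_self]) (by simp) (fun x hxy => ?_) x
  have hd := degree_pos_of_ne hG hxy
  have h0 : ∀ z, 0 ≤ G.weight s(x, z) / G.degree x :=
    fun z => div_nonneg (G.weight_nonneg _) hd.le
  unfold stepMeasure
  rw [if_neg hd.ne', lintegral_finsetSum_measure]
  simp only [lintegral_smul_measure, lintegral_dirac, smul_eq_mul]
  simp_rw [← ENNReal.ofReal_mul (h0 _)]
  rw [← ENNReal.ofReal_sum_of_nonneg fun z _ => mul_nonneg (h0 z) (treeHit_nonneg _ _),
    ← ENNReal.ofReal_one, ← ENNReal.ofReal_add zero_le_one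
      (Finset.sum_nonneg fun z _ => mul_nonneg (h0 z) (treeHit_nonneg _ _))]
  congr 1
  have h := sum_weight_mul_treeHit_sub hG hxy
  simp only [mul_sub, Finset.sum_sub_distrib, ← Finset.sum_mul] at h
  have h' : ∑ z, G.weight s(x, z) = G.degree x := rfl
  rw [h'] at h
  simp_rw [div_mul_eq_mul_div]
  rw [← Finset.sum_div]
  field_simp
  linarith

variable (G) in
open Classical in
/-- The sum `∑ k (n - k) / ω(e)` over the edges `e`, where `k` and `n - k` are the numbers of
vertices on the two sides of `e`. -/
noncomputable def cutSum : ℝ :=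
  ∑ e ∈ G.graph.edgeFinset,
    (G.graph.edgeBalance e * ((Fintype.card V : ℝ) - G.graph.edgeBalance e)) / G.weight e

open Classical in
lemma sum_edgeWeights : G.edgeWeights.sum = ∑ e ∈ G.graph.edgeFinset, G.weight e := by
  unfold edgeWeights
  rfl

lemma sum_degree : ∑ x, G.degree x = 2 * G.edgeWeights.sum := by
  classical
  rw [sum_edgeWeights, ← SimpleGraph.sum_adj_eq_two_mul_sum_edgeFinset]
  refine Finset.sum_congr rfl fun x _ => ?_
  simpa [degree] using sum_adj_eq_sum_weight (G := G) x fun _ => 1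

lemma sum_treeHit (hG : G.graph.IsTree) :
    ∑ x, ∑ y, G.treeHit x y = 2 * G.edgeWeights.sum * G.cutSum := by
  classical
  let g : V → V → ℝ := fun a b => if G.graph.Adj a b then
    (G.graph.branch a b).card * (G.graph.branch b a).card / G.weight s(a, b) else 0
  have hg : ∀ a b, g a b = g b a := by
    intro a b
    simp only [g, Sym2.eq_swap (a := a) (b := b), G.graph.adj_comm a b]
    congr 2
    ring
  have h1 : ∑ x, ∑ y, G.treeHit x y =
      ∑ a, ∑ b, g a b * ∑ v ∈ G.graph.branch b a, G.degree v := by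
    have swap : ∀ f : V → V → V → ℝ, ∑ x, ∑ y, ∑ a, f x y a = ∑ a, ∑ x, ∑ y, f x y a :=
      fun f => (Finset.sum_congr rfl fun x _ => Finset.sum_comm).trans Finset.sum_comm
    unfold treeHit
    rw [swap]
    refine Finset.sum_congr rfl fun a _ => ?_
    rw [swap]
    refine Finset.sum_congr rfl fun b _ => ?_
    by_cases h : G.graph.Adj a b
    · have h2 : ∀ x y : V, (if G.graph.Adj a b ∧ x ∉ G.graph.branch a b ∧
          y ∈ G.graph.branch a b then
          (∑ v ∈ G.graph.branch b a, G.degree v) / G.weight s(a, b) else 0) =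
          (if x ∈ G.graph.branch b a then (1 : ℝ) else 0) *
            (if y ∈ G.graph.branch a b then (1 : ℝ) else 0) *
            ((∑ v ∈ G.graph.branch b a, G.degree v) / G.weight s(a, b)) := by
        intro x y
        simp only [h, true_and, ← hG.mem_branch_swap h]
        by_cases hx : x ∈ G.graph.branch b a <;> by_cases hy : y ∈ G.graph.branch a b <;>
          simp [hx, hy]
      simp only [h2, ← Finset.sum_mul, ← Finset.mul_sum]
      simp only [Finset.sum_boole, Finset.filter_univ_mem, g, h, if_true]
      ring
    · simp [h, g]
  have h2 : ∑ a, ∑ b, g a b * ∑ v ∈ G.graph.branch b a, G.degree v =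
      ∑ a, ∑ b, g a b * ∑ v ∈ G.graph.branch a b, G.degree v := by
    rw [Finset.sum_comm]
    simp_rw [hg]
  have h3 : ∑ a, ∑ b, g a b = 2 * G.cutSum := by
    unfold cutSum
    rw [← SimpleGraph.sum_adj_eq_two_mul_sum_edgeFinset]
    refine Finset.sum_congr rfl fun a _ => Finset.sum_congr rfl fun b _ => ?_
    by_cases h : G.graph.Adj a b
    · simp only [g, h, if_true]
      congr 1
      rw [SimpleGraph.edgeBalance_mk, ← hG.card_branch_add h]
      rcases min_cases (G.graph.branch a b).card (G.graph.branch b a).card with h' | h' <;>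
        rw [h'.1] <;> push_cast <;> ring
    · simp [g, h]
  have h4 : 2 * ∑ x, ∑ y, G.treeHit x y = ∑ a, ∑ b, g a b * ∑ v, G.degree v := by
    rw [two_mul]
    nth_rewrite 1 [h1]
    rw [h1.trans h2, ← Finset.sum_add_distrib]
    refine Finset.sum_congr rfl fun a _ => ?_
    rw [← Finset.sum_add_distrib]
    refine Finset.sum_congr rfl fun b _ => ?_
    by_cases h : G.graph.Adj a b
    · rw [← mul_add, add_comm, hG.branch_swap h, Finset.sum_add_sum_compl]
    · simp [g, h]
  simp only [← Finset.sum_mul, h3, sum_degree] at h4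
  linarith

/-- The average hitting time of a weighted tree. -/
lemma averageHittingTime_eq (hG : G.graph.IsTree) :
    G.averageHittingTime =
      ENNReal.ofReal (2 * G.edgeWeights.sum * G.cutSum) / (Fintype.card V : ℝ≥0∞) ^ 2 := by
  unfold averageHittingTime
  simp_rw [hittingTime_eq hG]
  rw [← sum_treeHit hG, ENNReal.ofReal_sum_of_nonneg
    fun x _ => Finset.sum_nonneg fun y _ => treeHit_nonneg x y]
  simp_rw [ENNReal.ofReal_sum_of_nonneg fun (y : V) _ => treeHit_nonneg _ y]

end WeightedGraph

/-! ### Rearrangement -/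

/-- Two families with the same multiset of values differ by a bijection of the index sets. -/
lemma exists_equiv_of_map_univ_eq {ι κ α : Type*} [Fintype ι] [Fintype κ] {f : ι → α}
    {g : κ → α} (h : (Finset.univ : Finset ι).val.map f = (Finset.univ : Finset κ).val.map g) :
    ∃ σ : ι ≃ κ, ∀ i, g (σ i) = f i := by
  classical
  have hcard : ∀ a, Fintype.card {i // f i = a} = Fintype.card {k // g k = a} := by
    intro a
    have := congrArg (Multiset.count a) h
    rw [Multiset.count_map, Multiset.count_map] at this
    rw [Fintype.card_subtype, Fintype.card_subtype, Finset.card_def, Finset.card_def,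
      Finset.filter_val, Finset.filter_val]
    simpa only [eq_comm] using this
  refine ⟨(Equiv.sigmaFiberEquiv f).symm.trans ((Equiv.sigmaCongrRight fun a =>
    Fintype.equivOfCardEq (hcard a)).trans (Equiv.sigmaFiberEquiv g)), fun i => ?_⟩
  exact (Fintype.equivOfCardEq (hcard (f i)) ⟨i, rfl⟩).2

/-- Among the sets of at most a given size, the sum of a positive function is the largest exactly
for the sets of that size that consist of the largest values. -/
lemma sum_le_sum_of_top {ι : Type*} {r : ι → ℝ} (hr : ∀ i, 0 < r i) {S T : Finset ι}
    (hcard : S.card ≤ T.card) (htop : ∀ i ∈ T, ∀ k ∉ T, r k ≤ r i) :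
    ∑ i ∈ S, r i ≤ ∑ i ∈ T, r i ∧
      (∑ i ∈ S, r i = ∑ i ∈ T, r i → S.card = T.card ∧ ∀ i ∈ S, ∀ k ∉ S, r k ≤ r i) := by
  classical
  have hc : (S \ T).card ≤ (T \ S).card := by
    have h1 := Finset.card_sdiff_add_card_inter S T
    have h2 := Finset.card_sdiff_add_card_inter T S
    rw [Finset.inter_comm] at h2
    omega
  rcases (T \ S).eq_empty_or_nonempty with h0 | h0
  · have : S = T := by
      rw [h0, Finset.card_empty, Nat.le_zero, Finset.card_eq_zero] at hc
      exact (Finset.sdiff_eq_empty_iff_subset.1 hc).antisymm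
        (Finset.sdiff_eq_empty_iff_subset.1 h0)
    subst this
    exact ⟨le_rfl, fun _ => ⟨rfl, htop⟩⟩
  obtain ⟨m, hm, hmin⟩ := (T \ S).exists_min_image r h0
  have hmT := (Finset.mem_sdiff.1 hm).1
  have hmS := (Finset.mem_sdiff.1 hm).2
  have hSle : ∀ i ∈ S \ T, r i ≤ r m := fun i hi => htop m hmT i (Finset.mem_sdiff.1 hi).2
  have h1 : ∑ i ∈ S \ T, r i ≤ (S \ T).card * r m := by
    simpa using Finset.sum_le_card_nsmul (S \ T) r (r m) hSle
  have h2 : (T \ S).card * r m ≤ ∑ i ∈ T \ S, r i := by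
    simpa using Finset.card_nsmul_le_sum (T \ S) r (r m) hmin
  have h3 : ((S \ T).card : ℝ) * r m ≤ (T \ S).card * r m :=
    mul_le_mul_of_nonneg_right (by exact_mod_cast hc) (hr m).le
  have e1 : ∑ i ∈ S \ T, r i + ∑ i ∈ S ∩ T, r i = ∑ i ∈ S, r i := by
    rw [add_comm, Finset.sum_inter_add_sum_sdiff]
  have e2 : ∑ i ∈ T \ S, r i + ∑ i ∈ S ∩ T, r i = ∑ i ∈ T, r i := by
    rw [Finset.inter_comm, add_comm, Finset.sum_inter_add_sum_sdiff]
  refine ⟨by linarith, fun heq => ?_⟩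
  have h4 : (S \ T).card = (T \ S).card := by
    have : ((S \ T).card : ℝ) * r m = (T \ S).card * r m := by linarith
    exact_mod_cast mul_right_cancel₀ (hr m).ne' this
  have h5 : ∀ i ∈ S \ T, r i = r m := by
    refine (Finset.sum_eq_sum_iff_of_le hSle).1 ?_
    rw [Finset.sum_const, nsmul_eq_mul]
    linarith
  constructor
  · have h1 := Finset.card_sdiff_add_card_inter S T
    have h2 := Finset.card_sdiff_add_card_inter T S
    rw [Finset.inter_comm] at h2
    omega
  · have hbelow : ∀ k ∉ S, r k ≤ r m := by
      intro k hk
      by_cases hkT : k ∈ T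
      · obtain ⟨i, hi⟩ : (S \ T).Nonempty := by
          rw [← Finset.card_pos, h4]
          exact Finset.card_pos.2 h0
        have h6 : ∑ i ∈ T \ S, r i = ∑ _i ∈ T \ S, r m := by
          rw [Finset.sum_const, nsmul_eq_mul]
          linarith
        exact ((Finset.sum_eq_sum_iff_of_le hmin).1 h6.symm k
          (Finset.mem_sdiff.2 ⟨hkT, hk⟩)).ge
      · exact htop m hmT k hkT
    intro i hi k hk
    refine (hbelow k hk).trans ?_
    by_cases hiT : i ∈ T
    · obtain ⟨l, hl⟩ : (S \ T).Nonempty := by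
        rw [← Finset.card_pos, h4]
        exact Finset.card_pos.2 h0
      rw [← h5 l hl]
      exact htop i hiT l (Finset.mem_sdiff.1 hl).2
    · exact (h5 i (Finset.mem_sdiff.2 ⟨hi, hiT⟩)).ge

lemma mul_sub_eq_sum_Icc {n c : ℕ} (h : 2 * c ≤ n) :
    (c : ℝ) * (n - c) = ∑ j ∈ Finset.Icc 1 (n / 2), if j ≤ c then ((n : ℝ) + 1 - 2 * j) else 0 := by
  have h1 : (Finset.Icc 1 (n / 2)).filter (fun j => j ≤ c) = Finset.Icc 1 c := by
    ext j
    simp only [Finset.mem_filter, Finset.mem_Icc]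
    omega
  rw [← Finset.sum_filter, h1]
  clear h h1
  induction c with
  | zero => simp
  | succ c ih =>
    rw [Finset.sum_Icc_succ_top (by omega), ← ih]
    push_cast
    ring

/-- Writing `c (n - c)` as the sum of the `n + 1 - 2j` over the levels `1 ≤ j ≤ c` decomposes
`∑ c (n - c) r`. -/
lemma sum_mul_sub_eq {ι : Type*} [Fintype ι] {n : ℕ} {c : ι → ℕ} (hc : ∀ i, 2 * c i ≤ n)
    (r : ι → ℝ) :
    ∑ i, c i * ((n : ℝ) - c i) * r i =
      ∑ j ∈ Finset.Icc 1 (n / 2), ((n : ℝ) + 1 - 2 * j) *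
        ∑ i ∈ Finset.univ.filter (fun i => j ≤ c i), r i := by
  simp_rw [mul_sub_eq_sum_Icc (hc _), Finset.sum_mul]
  rw [Finset.sum_comm]
  refine Finset.sum_congr rfl fun j _ => ?_
  rw [Finset.mul_sum, Finset.sum_filter]
  refine Finset.sum_congr rfl fun i _ => ?_
  split_ifs <;> simp

/-- If no superlevel set of `c` is larger than that of `d`, and if `d` is similarly ordered to
`r`, then `∑ c (n - c) r ≤ ∑ d (n - d) r`. In case of equality, the superlevel sets have equal
sizes, and `c` is also similarly ordered to `r`. -/
lemma sum_mul_sub_le {ι : Type*} [Fintype ι] {n : ℕ} {c d : ι → ℕ} {r : ι → ℝ}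
    (hr : ∀ i, 0 < r i) (hc : ∀ i, 2 * c i ≤ n) (hd : ∀ i, 2 * d i ≤ n)
    (hcard : ∀ j, 1 ≤ j → 2 * j ≤ n → (Finset.univ.filter fun i => j ≤ c i).card ≤
      (Finset.univ.filter fun i => j ≤ d i).card)
    (hdr : ∀ i k, d k < d i → r k ≤ r i) :
    ∑ i, c i * ((n : ℝ) - c i) * r i ≤ ∑ i, d i * ((n : ℝ) - d i) * r i ∧
      (∑ i, c i * ((n : ℝ) - c i) * r i = ∑ i, d i * ((n : ℝ) - d i) * r i →
        (∀ j, 1 ≤ j → 2 * j ≤ n → (Finset.univ.filter fun i => j ≤ c i).card =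
          (Finset.univ.filter fun i => j ≤ d i).card) ∧ ∀ i k, c k < c i → r k ≤ r i) := by
  have key : ∀ j ∈ Finset.Icc 1 (n / 2), 0 < (n : ℝ) + 1 - 2 * j ∧
      (∑ i ∈ Finset.univ.filter (fun i => j ≤ c i), r i ≤
        ∑ i ∈ Finset.univ.filter (fun i => j ≤ d i), r i ∧
      (∑ i ∈ Finset.univ.filter (fun i => j ≤ c i), r i =
        ∑ i ∈ Finset.univ.filter (fun i => j ≤ d i), r i →
        (Finset.univ.filter fun i => j ≤ c i).card = (Finset.univ.filter fun i => j ≤ d i).card ∧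
        ∀ i ∈ Finset.univ.filter (fun i => j ≤ c i),
          ∀ k ∉ Finset.univ.filter (fun i => j ≤ c i), r k ≤ r i)) := by
    intro j hj
    obtain ⟨h1, h2⟩ := Finset.mem_Icc.1 hj
    have h3 : 2 * j ≤ n := by omega
    refine ⟨?_, sum_le_sum_of_top hr (hcard j h1 h3) fun i hi k hk => hdr i k ?_⟩
    · have : (2 : ℝ) * j ≤ n := by exact_mod_cast h3
      linarith
    · simp only [Finset.mem_filter, Finset.mem_univ, true_and] at hi hk
      omega
  have hle : ∀ j ∈ Finset.Icc 1 (n / 2),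
      ((n : ℝ) + 1 - 2 * j) * ∑ i ∈ Finset.univ.filter (fun i => j ≤ c i), r i ≤
      ((n : ℝ) + 1 - 2 * j) * ∑ i ∈ Finset.univ.filter (fun i => j ≤ d i), r i :=
    fun j hj => mul_le_mul_of_nonneg_left (key j hj).2.1 (key j hj).1.le
  rw [sum_mul_sub_eq hc, sum_mul_sub_eq hd]
  refine ⟨Finset.sum_le_sum hle, fun heq => ?_⟩
  have heq' := fun j hj => mul_left_cancel₀ (key j hj).1.ne'
    ((Finset.sum_eq_sum_iff_of_le hle).1 heq j hj)
  refine ⟨fun j h1 h2 => ?_, fun i k hik => ?_⟩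
  · have hj : j ∈ Finset.Icc 1 (n / 2) := Finset.mem_Icc.2 ⟨h1, by omega⟩
    exact ((key j hj).2.2 (heq' j hj)).1
  · have hj : c i ∈ Finset.Icc 1 (n / 2) :=
      Finset.mem_Icc.2 ⟨by omega, by have := hc i; omega⟩
    exact ((key _ hj).2.2 (heq' _ hj)).2 i (by simp) k (by simpa using hik)

namespace WeightedGraph

/-! ### Comparison of trees with the same edge-weights -/

variable {V : Type u} [Fintype V] {V' : Type v} [Fintype V'] {W : Multiset ℝ}

open Classical in
lemma edgeWeights_eq_map_univ (G : WeightedGraph V) :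
    G.edgeWeights = (Finset.univ : Finset G.graph.edgeFinset).val.map
      fun e : G.graph.edgeFinset => G.weight e := by
  rw [edgeWeights, Finset.univ_eq_attach, Finset.attach_val]
  exact (Multiset.attach_map_val' _ _).symm

lemma IsTreeWithWeights.card_eq {G : WeightedGraph V} (hG : G.IsTreeWithWeights W) :
    Fintype.card V = Multiset.card W + 1 := by
  classical
  rw [← hG.1.card_edgeFinset, ← hG.2, edgeWeights, Multiset.card_map, Finset.card_def]

lemma IsTreeWithWeights.cutSum_eq_zero {G : WeightedGraph V} (hG : G.IsTreeWithWeights 0) :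
    G.cutSum = 0 := by
  classical
  have h := hG.2
  rw [edgeWeights, Multiset.map_eq_zero] at h
  rw [cutSum, Finset.val_eq_zero.1 h, Finset.sum_empty]

lemma IsTreeWithWeights.averageHittingTime_le_iff {T : WeightedGraph V} {T' : WeightedGraph V'}
    (hT : T.IsTreeWithWeights W) (hT' : T'.IsTreeWithWeights W) (hW : ∀ w ∈ W, 0 < w) :
    T.averageHittingTime ≤ T'.averageHittingTime ↔ T.cutSum ≤ T'.cutSum := by
  classical
  rw [averageHittingTime_eq hT.1, averageHittingTime_eq hT'.1, hT.card_eq, hT'.card_eq, hT.2,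
    hT'.2]
  rcases eq_or_ne W 0 with rfl | hne
  · simp [hT.cutSum_eq_zero, hT'.cutSum_eq_zero]
  · have hpos : 0 < W.sum := by
      obtain ⟨w, hw⟩ := Multiset.exists_mem_of_ne_zero hne
      exact (hW w hw).trans_le (Multiset.single_le_sum (fun w hw => (hW w hw).le) w hw)
    rw [div_eq_mul_inv, div_eq_mul_inv, ENNReal.mul_le_mul_iff_left (by simp) (by simp),
      ENNReal.ofReal_le_ofReal_iff, mul_le_mul_iff_right₀ (by positivity)]
    refine mul_nonneg (by positivity) (Finset.sum_nonneg fun e he => ?_)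
    refine div_nonneg (mul_nonneg (by positivity) ?_) (T'.weight_nonneg e)
    have h1 := hT'.1.two_mul_edgeBalance_le (SimpleGraph.mem_edgeFinset.1 he)
    have h2 : T'.graph.edgeBalance e ≤ Fintype.card V' := by omega
    rw [sub_nonneg]
    exact_mod_cast h2

/-- Among the trees with the same edge-weights, `cutSum` is the largest for the polarized paths,
and only for these. -/
lemma IsTreeWithWeights.cutSum_le {T : WeightedGraph V} {P : WeightedGraph V'}
    (hT : T.IsTreeWithWeights W) (hP : P.IsTreeWithWeights W) (hpol : P.IsPolarizedPath) :
    T.cutSum ≤ P.cutSum ∧ (T.cutSum = P.cutSum → T.IsPolarizedPath) := by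
  classical
  have hn : Fintype.card V' = Fintype.card V := hP.card_eq.trans hT.card_eq.symm
  obtain ⟨σ, hσ⟩ := exists_equiv_of_map_univ_eq
    (T.edgeWeights_eq_map_univ.symm.trans (hT.2.trans (hP.2.symm.trans P.edgeWeights_eq_map_univ)))
  obtain ⟨p, hp⟩ := hpol
  have hTe : ∀ e : T.graph.edgeFinset, e.1 ∈ T.graph.edgeSet :=
    fun e => SimpleGraph.mem_edgeFinset.1 e.2
  have hPe : ∀ e : P.graph.edgeFinset, e.1 ∈ P.graph.edgeSet :=
    fun e => SimpleGraph.mem_edgeFinset.1 e.2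
  have hTcard : ∀ j : ℕ, (Finset.univ.filter fun e : T.graph.edgeFinset =>
      j ≤ T.graph.edgeBalance e).card =
      (T.graph.edgeFinset.filter fun e => j ≤ T.graph.edgeBalance e).card := by
    intro j
    simp only [Finset.card_filter]
    exact Finset.sum_coe_sort T.graph.edgeFinset fun e => if j ≤ T.graph.edgeBalance e then 1 else 0
  have hPcard : ∀ j : ℕ, (Finset.univ.filter fun e : T.graph.edgeFinset =>
      j ≤ P.graph.edgeBalance (σ e)).card =
      (P.graph.edgeFinset.filter fun e => j ≤ P.graph.edgeBalance e).card := by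
    intro j
    simp only [Finset.card_filter]
    rw [← Finset.sum_coe_sort P.graph.edgeFinset fun e =>
      if j ≤ P.graph.edgeBalance e then 1 else 0]
    exact Equiv.sum_comp σ fun e => if j ≤ P.graph.edgeBalance e then 1 else 0
  have hTsum : T.cutSum = ∑ e : T.graph.edgeFinset, T.graph.edgeBalance e *
      ((Fintype.card V : ℝ) - T.graph.edgeBalance e) * (T.weight e)⁻¹ := by
    simp only [cutSum, div_eq_mul_inv]
    exact (Finset.sum_coe_sort T.graph.edgeFinset fun e => T.graph.edgeBalance e *
      ((Fintype.card V : ℝ) - T.graph.edgeBalance e) * (T.weight e)⁻¹).symm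
  have hPsum : P.cutSum = ∑ e : T.graph.edgeFinset, P.graph.edgeBalance (σ e) *
      ((Fintype.card V : ℝ) - P.graph.edgeBalance (σ e)) * (T.weight e)⁻¹ := by
    simp only [cutSum, div_eq_mul_inv, hn, ← hσ]
    rw [Equiv.sum_comp σ fun e => (P.graph.edgeBalance e : ℝ) *
      ((Fintype.card V : ℝ) - P.graph.edgeBalance e) * (P.weight e)⁻¹]
    exact (Finset.sum_coe_sort P.graph.edgeFinset fun e => P.graph.edgeBalance e *
      ((Fintype.card V : ℝ) - P.graph.edgeBalance e) * (P.weight e)⁻¹).symm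
  have hr : ∀ e : T.graph.edgeFinset, 0 < (T.weight e)⁻¹ :=
    fun e => inv_pos.2 (T.weight_pos _ (hTe e))
  have hPpath : ∀ j, 1 ≤ j → 2 * j ≤ Fintype.card V →
      (P.graph.edgeFinset.filter fun e => j ≤ P.graph.edgeBalance e).card + 2 * j =
        Fintype.card V + 1 := fun j h1 h2 => by
    rw [hP.1.card_le_edgeBalance_of_iso_pathGraph p h1 (hn ▸ h2), hn]
  obtain ⟨hle, heq⟩ := sum_mul_sub_le (n := Fintype.card V)
    (c := fun e : T.graph.edgeFinset => T.graph.edgeBalance e)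
    (d := fun e : T.graph.edgeFinset => P.graph.edgeBalance (σ e)) hr
    (fun e => hT.1.two_mul_edgeBalance_le (hTe e))
    (fun e => hn ▸ hP.1.two_mul_edgeBalance_le (hPe (σ e)))
    (fun j h1 h2 => by
      rw [hTcard j, hPcard j]
      have h3 := hT.1.card_le_edgeBalance h2
      have h4 := hPpath j h1 h2
      omega)
    (fun e e' h => by
      obtain ⟨i, hi, he⟩ := SimpleGraph.exists_edge_eq_of_iso_pathGraph p (hPe (σ e))
      obtain ⟨k, hk, he'⟩ := SimpleGraph.exists_edge_eq_of_iso_pathGraph p (hPe (σ e'))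
      rw [← hσ e, ← hσ e']
      refine inv_anti₀ (P.weight_pos _ (hPe (σ e))) ?_
      rw [he, he'] at h ⊢
      rw [hP.1.edgeBalance_of_iso_pathGraph p hi, hP.1.edgeBalance_of_iso_pathGraph p hk] at h
      exact hp k i hk hi h)
  rw [← hTsum, ← hPsum] at hle heq
  refine ⟨hle, fun h => ?_⟩
  obtain ⟨hcard, hord⟩ := heq h
  obtain ⟨t⟩ := hT.1.exists_iso_pathGraph fun h4 => by
    have h1 := hcard 2 (by omega) (by omega)
    rw [hTcard 2, hPcard 2] at h1
    have h2 := hPpath 2 (by omega) (by omega)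
    have h3 := hT.1.card_edgeFinset
    rw [← Finset.card_filter_add_card_filter_not (p := fun e => T.graph.edgeBalance e = 1)] at h3
    have h5 : (T.graph.edgeFinset.filter fun e => ¬ T.graph.edgeBalance e = 1) =
        T.graph.edgeFinset.filter fun e => 2 ≤ T.graph.edgeBalance e := by
      refine Finset.filter_congr fun e _ => ?_
      have := SimpleGraph.edgeBalance_pos (G := T.graph) e
      omega
    rw [h5] at h3
    omega
  refine ⟨t, fun i j hi hj hij => ?_⟩
  have hadj : ∀ (i : ℕ) (hi : i + 1 < Fintype.card V),
      s(t ⟨i, by omega⟩, t ⟨i + 1, hi⟩) ∈ T.graph.edgeFinset := by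
    intro i hi
    rw [SimpleGraph.mem_edgeFinset, SimpleGraph.mem_edgeSet, t.map_adj_iff,
      SimpleGraph.pathGraph_adj]
    exact Or.inl rfl
  rw [← hT.1.edgeBalance_of_iso_pathGraph t hi, ← hT.1.edgeBalance_of_iso_pathGraph t hj] at hij
  have := hord ⟨_, hadj j hj⟩ ⟨_, hadj i hi⟩ hij
  exact (inv_le_inv₀ (T.weight_pos _ (hTe ⟨_, hadj i hi⟩))
    (T.weight_pos _ (hTe ⟨_, hadj j hj⟩))).1 this

/-- Among the trees with the same edge-weights, `cutSum` is the smallest for the stars, and only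
for these. -/
lemma IsTreeWithWeights.cutSum_star_le {T : WeightedGraph V} {S : WeightedGraph V'}
    (hT : T.IsTreeWithWeights W) (hS : S.IsTreeWithWeights W) {z : V'}
    (hz : ∀ x y, S.graph.Adj x y → x = z ∨ y = z) :
    S.cutSum ≤ T.cutSum ∧ (T.cutSum = S.cutSum →
      ∃ z, ∀ x y, T.graph.Adj x y ↔ x ≠ y ∧ (x = z ∨ y = z)) := by
  classical
  have hn : Fintype.card V' = Fintype.card V := hS.card_eq.trans hT.card_eq.symm
  have hSsum : S.cutSum = ∑ e ∈ T.graph.edgeFinset, ((Fintype.card V : ℝ) - 1) / T.weight e := by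
    have h1 : S.cutSum = (S.edgeWeights.map fun w => ((Fintype.card V : ℝ) - 1) / w).sum := by
      rw [edgeWeights, Multiset.map_map, cutSum]
      refine Finset.sum_congr rfl fun e he => ?_
      rw [hS.1.edgeBalance_of_center hz (SimpleGraph.mem_edgeFinset.1 he), hn]
      simp
    rw [h1, hS.2, ← hT.2, edgeWeights, Multiset.map_map]
    rfl
  have hterm : ∀ e ∈ T.graph.edgeFinset, ((Fintype.card V : ℝ) - 1) / T.weight e ≤
      (T.graph.edgeBalance e * ((Fintype.card V : ℝ) - T.graph.edgeBalance e)) / T.weight e ∧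
      (((Fintype.card V : ℝ) - 1) / T.weight e =
        (T.graph.edgeBalance e * ((Fintype.card V : ℝ) - T.graph.edgeBalance e)) / T.weight e →
        T.graph.edgeBalance e = 1) := by
    intro e he
    have he' := SimpleGraph.mem_edgeFinset.1 he
    have hw := T.weight_pos e he'
    have h1 : (2 : ℝ) * T.graph.edgeBalance e ≤ Fintype.card V := by
      exact_mod_cast hT.1.two_mul_edgeBalance_le he'
    have h2 : (1 : ℝ) ≤ T.graph.edgeBalance e := by
      exact_mod_cast SimpleGraph.edgeBalance_pos (G := T.graph) e
    -- `c (n - c) - (n - 1) = (c - 1) (n - c - 1)`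
    have h3 : (0 : ℝ) ≤ (T.graph.edgeBalance e - 1) *
        (Fintype.card V - T.graph.edgeBalance e - 1) :=
      mul_nonneg (by linarith) (by linarith)
    refine ⟨div_le_div_of_nonneg_right (by linarith) hw.le, fun h => ?_⟩
    rw [div_left_inj' hw.ne'] at h
    have h4 : ((T.graph.edgeBalance e : ℝ) - 1) *
        (Fintype.card V - T.graph.edgeBalance e - 1) = 0 := by linarith
    have h5 : (T.graph.edgeBalance e : ℝ) = 1 := by
      rcases mul_eq_zero.1 h4 with h | h <;> linarith
    exact_mod_cast h5
  rw [hSsum, cutSum]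
  refine ⟨Finset.sum_le_sum fun e he => (hterm e he).1, fun h => hT.1.exists_center fun e he => ?_⟩
  have he' := SimpleGraph.mem_edgeFinset.2 he
  exact (hterm e he').2 ((Finset.sum_eq_sum_iff_of_le fun e he => (hterm e he).1).1 h.symm e he')

end WeightedGraph

/-! ### Isomorphisms -/

/-- Paths on equal numbers of vertices are isomorphic. -/
def SimpleGraph.pathGraphCast {m n : ℕ} (h : m = n) :
    SimpleGraph.pathGraph m ≃g SimpleGraph.pathGraph n :=
  ⟨finCongr h, by simp [SimpleGraph.pathGraph_adj]⟩

namespace WeightedGraph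

section Transport

variable {V : Type u} {V' : Type v} {W : Multiset ℝ}

/-- The copy of a weighted graph on a vertex set in bijection with its own. -/
def transport (G : WeightedGraph V) (e : V ≃ V') : WeightedGraph V' where
  graph := G.graph.comap e.symm
  weight s := G.weight (s.map e.symm)
  weight_pos s hs := by
    induction s using Sym2.ind with
    | _ x y => exact G.weight_pos _ hs
  weight_eq_zero s hs := by
    induction s using Sym2.ind with
    | _ x y => exact G.weight_eq_zero _ hs

/-- A weighted graph is isomorphic to its copies. -/
def isoTransport (G : WeightedGraph V) (e : V ≃ V') : G.Iso (G.transport e) where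
  toIso := ⟨e, by simp [transport]⟩
  weight_map x y := by
    change G.weight s(e.symm (e x), e.symm (e y)) = _
    simp

/-- Isomorphisms of weighted graphs can be inverted. -/
def Iso.symm {G : WeightedGraph V} {G' : WeightedGraph V'} (φ : G.Iso G') :
    G'.Iso G where
  toIso := φ.toIso.symm
  weight_map x y := by
    rw [← φ.weight_map, φ.toIso.apply_symm_apply, φ.toIso.apply_symm_apply]

variable [Fintype V] [Fintype V']

lemma Iso.edgeWeights_eq {G : WeightedGraph V} {G' : WeightedGraph V'} (φ : G.Iso G') :
    G'.edgeWeights = G.edgeWeights := by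
  classical
  have himg : G'.graph.edgeFinset = G.graph.edgeFinset.map
      ⟨Sym2.map φ.toIso, Sym2.map.injective φ.toIso.injective⟩ := by
    ext s
    induction s using Sym2.ind with
    | _ x y =>
      obtain ⟨x, rfl⟩ := φ.toIso.surjective x
      obtain ⟨y, rfl⟩ := φ.toIso.surjective y
      rw [show s(φ.toIso x, φ.toIso y) = (⟨Sym2.map φ.toIso, Sym2.map.injective
        φ.toIso.injective⟩ : Sym2 V ↪ Sym2 V') s(x, y) from rfl, Finset.mem_map']
      simp [φ.toIso.map_adj_iff]
  rw [edgeWeights, edgeWeights, himg, Finset.map_val, Multiset.map_map]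
  refine Multiset.map_congr rfl fun s _ => ?_
  induction s using Sym2.ind with
  | _ x y => exact φ.weight_map x y

lemma Iso.isTreeWithWeights {G : WeightedGraph V} {G' : WeightedGraph V'} (φ : G.Iso G')
    (hG : G.IsTreeWithWeights W) : G'.IsTreeWithWeights W :=
  ⟨φ.toIso.isTree_iff.1 hG.1, φ.edgeWeights_eq.trans hG.2⟩

lemma Iso.isPolarizedPath {G : WeightedGraph V} {G' : WeightedGraph V'} (φ : G.Iso G')
    (hG : G.IsPolarizedPath) : G'.IsPolarizedPath := by
  have hn : Fintype.card V' = Fintype.card V := (Fintype.card_congr φ.toIso.toEquiv).symm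
  obtain ⟨p, hp⟩ := hG
  refine ⟨(SimpleGraph.pathGraphCast hn).trans (p.trans φ.toIso), fun i j hi hj hij => ?_⟩
  simp only [RelIso.trans_apply, φ.weight_map]
  refine hp i j (by omega) (by omega) ?_
  simpa only [hn] using hij

end Transport

/-! ### Existence of polarized paths -/

/-- The path on `m + 1` vertices whose edge between the vertices `k` and `k + 1` has weight
`g k`. -/
noncomputable def weightedPath (m : ℕ) (g : Fin m → ℝ) (hg : ∀ k, 0 < g k) :
    WeightedGraph (Fin (m + 1)) where
  graph := SimpleGraph.pathGraph (m + 1)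
  weight := Sym2.lift ⟨fun x y =>
    if h : x.1 + 1 = y.1 then g ⟨x.1, by omega⟩ else
      if h : y.1 + 1 = x.1 then g ⟨y.1, by omega⟩ else 0, fun x y => by
        dsimp only
        split_ifs <;> first | rfl | omega⟩
  weight_pos s hs := by
    induction s using Sym2.ind with
    | _ x y =>
      rw [SimpleGraph.mem_edgeSet, SimpleGraph.pathGraph_adj] at hs
      simp only [Sym2.lift_mk]
      split_ifs
      · exact hg _
      · exact hg _
      · omega
  weight_eq_zero s hs := by
    induction s using Sym2.ind with
    | _ x y =>
      rw [SimpleGraph.mem_edgeSet, SimpleGraph.pathGraph_adj] at hs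
      simp only [Sym2.lift_mk]
      split_ifs
      · omega
      · omega
      · rfl

lemma weightedPath_weight {m : ℕ} {g : Fin m → ℝ} (hg : ∀ k, 0 < g k) (x y : Fin (m + 1))
    (h : x.1 + 1 = y.1) :
    (weightedPath m g hg).weight s(x, y) = g ⟨x.1, by omega⟩ := by
  simp [weightedPath, h]

lemma isTreeWithWeights_weightedPath {m : ℕ} {g : Fin m → ℝ} (hg : ∀ k, 0 < g k) :
    (weightedPath m g hg).IsTreeWithWeights ((Finset.univ : Finset (Fin m)).val.map g) := by
  classical
  let f : Fin m ↪ Sym2 (Fin (m + 1)) := ⟨fun k => s(k.castSucc, k.succ), fun k l h => by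
    rcases Sym2.eq_iff.1 h with ⟨h1, -⟩ | ⟨h1, h2⟩
    · exact Fin.castSucc_injective _ h1
    · rw [Fin.ext_iff] at h1 h2
      simp only [Fin.val_castSucc, Fin.val_succ] at h1 h2
      omega⟩
  have hE : (weightedPath m g hg).graph.edgeFinset = Finset.univ.map f := by
    ext s
    induction s using Sym2.ind with
    | _ x y =>
      rw [SimpleGraph.mem_edgeFinset, SimpleGraph.mem_edgeSet, Finset.mem_map]
      change (SimpleGraph.pathGraph (m + 1)).Adj x y ↔ _
      rw [SimpleGraph.pathGraph_adj]
      constructor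
      · rintro (h | h)
        · refine ⟨⟨x.1, by omega⟩, Finset.mem_univ _, Sym2.eq_iff.2 (Or.inl ⟨?_, ?_⟩)⟩ <;>
            ext <;> simp [h]
        · refine ⟨⟨y.1, by omega⟩, Finset.mem_univ _, Sym2.eq_iff.2 (Or.inr ⟨?_, ?_⟩)⟩ <;>
            ext <;> simp [h]
      · rintro ⟨k, -, hk⟩
        rcases Sym2.eq_iff.1 hk with ⟨rfl, rfl⟩ | ⟨rfl, rfl⟩
        · exact Or.inl rfl
        · exact Or.inr rfl
  refine ⟨SimpleGraph.isTree_iff_connected_and_card.2 ⟨SimpleGraph.pathGraph_connected m, ?_⟩, ?_⟩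
  · rw [Nat.card_eq_fintype_card, ← SimpleGraph.edgeFinset_card, hE]
    simp
  · rw [edgeWeights, hE, Finset.map_val, Multiset.map_map]
    refine Multiset.map_congr rfl fun k _ => ?_
    exact weightedPath_weight hg _ _ rfl

lemma isPolarizedPath_weightedPath {m : ℕ} {g : Fin m → ℝ} (hg : ∀ k, 0 < g k)
    (h : ∀ i j : Fin m, min (i.1 + 1) (m + 1 - (i.1 + 1)) < min (j.1 + 1) (m + 1 - (j.1 + 1)) →
      g j ≤ g i) :
    (weightedPath m g hg).IsPolarizedPath := by
  have hn : Fintype.card (Fin (m + 1)) = m + 1 := Fintype.card_fin _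
  refine ⟨SimpleGraph.pathGraphCast hn, fun i j hi hj hij => ?_⟩
  rw [weightedPath_weight hg _ _ rfl, weightedPath_weight hg _ _ rfl]
  refine h ⟨i, by omega⟩ ⟨j, by omega⟩ ?_
  simpa only [hn] using hij

/-- The elements of a multiset can be arranged in the opposite order to a given function. -/
lemma exists_arrangement {m : ℕ} (W : Multiset ℝ) (hm : m = Multiset.card W) (c : Fin m → ℕ) :
    ∃ g : Fin m → ℝ, (Finset.univ : Finset (Fin m)).val.map g = W ∧
      ∀ i j, c i < c j → g j ≤ g i := by
  set L := W.sort (· ≥ ·) with hL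
  have hlen : m = L.length := by rw [hm, hL, Multiset.length_sort]
  let e : Fin m ≃ Fin L.length := (Tuple.sort c).symm.trans (finCongr hlen)
  refine ⟨fun i => L.get (e i), ?_, fun i j hij => ?_⟩
  · have : (Finset.univ : Finset (Fin m)).val.map (fun i => L.get (e i)) =
        ((Finset.univ : Finset (Fin m)).val.map e).map L.get := by
      rw [Multiset.map_map]
      rfl
    rw [this, Multiset.map_univ_val_equiv, Fin.univ_val_map, List.ofFn_get, hL,
      Multiset.sort_eq]
  · have hlt : (Tuple.sort c).symm i < (Tuple.sort c).symm j := by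
      by_contra hcon
      have := Tuple.monotone_sort c (not_lt.1 hcon)
      simp only [Function.comp_apply, Equiv.apply_symm_apply] at this
      omega
    exact List.pairwise_iff_get.1 (Multiset.pairwise_sort W (· ≥ ·)) (e i) (e j) hlt

lemma exists_isPolarizedPath (W : Multiset ℝ) (hW : ∀ w ∈ W, 0 < w) :
    ∃ P : WeightedGraph (Fin (Multiset.card W + 1)),
      P.IsTreeWithWeights W ∧ P.IsPolarizedPath := by
  obtain ⟨g, hg, hc⟩ := exists_arrangement W rfl
    fun i => min (i.1 + 1) (Multiset.card W + 1 - (i.1 + 1))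
  have hpos : ∀ k, 0 < g k := fun k => hW _ (by
    rw [← hg]
    exact Multiset.mem_map_of_mem g (Finset.mem_univ k))
  refine ⟨weightedPath _ g hpos, ?_, isPolarizedPath_weightedPath hpos hc⟩
  have := isTreeWithWeights_weightedPath hpos
  rwa [hg] at this

/-! ### Stars -/

section Star

variable {V : Type u} {W : Multiset ℝ}

lemma Iso.exists_center_of_star {G : WeightedGraph V} {hW : ∀ w ∈ W, 0 < w}
    (φ : (star W hW).Iso G) : ∃ z, ∀ x y, G.graph.Adj x y → x = z ∨ y = z := by
  refine ⟨φ.toIso none, fun x y h => ?_⟩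
  obtain ⟨x, rfl⟩ := φ.toIso.surjective x
  obtain ⟨y, rfl⟩ := φ.toIso.surjective y
  rw [φ.toIso.map_adj_iff] at h
  rw [φ.toIso.injective.eq_iff, φ.toIso.injective.eq_iff]
  exact (SimpleGraph.starGraph_adj.1 h).2

variable [Fintype V]

lemma edgeWeights_of_center {G : WeightedGraph V} {z : V}
    (hz : ∀ x y, G.graph.Adj x y ↔ x ≠ y ∧ (x = z ∨ y = z)) {ι : Type*} [Fintype ι] {f : ι → V}
    (hf : Function.Injective f) (hfz : ∀ x, x ≠ z ↔ ∃ i, f i = x) :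
    G.edgeWeights = (Finset.univ : Finset ι).val.map fun i => G.weight s(z, f i) := by
  classical
  let F : ι ↪ Sym2 V := ⟨fun i => s(z, f i), fun i j h => hf (Sym2.congr_right.1 h)⟩
  have hE : G.graph.edgeFinset = Finset.univ.map F := by
    ext s
    induction s using Sym2.ind with
    | _ x y =>
      rw [SimpleGraph.mem_edgeFinset, SimpleGraph.mem_edgeSet, hz, Finset.mem_map]
      constructor
      · rintro ⟨hne, rfl | rfl⟩
        · obtain ⟨i, rfl⟩ := (hfz y).1 hne.symm
          exact ⟨i, Finset.mem_univ _, rfl⟩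
        · obtain ⟨i, rfl⟩ := (hfz x).1 hne
          exact ⟨i, Finset.mem_univ _, Sym2.eq_swap⟩
      · rintro ⟨i, -, hi⟩
        have hi' : f i ≠ z := (hfz _).2 ⟨i, rfl⟩
        rcases Sym2.eq_iff.1 hi with ⟨rfl, rfl⟩ | ⟨rfl, rfl⟩
        · exact ⟨hi'.symm, Or.inl rfl⟩
        · exact ⟨hi', Or.inr rfl⟩
  rw [edgeWeights, hE, Finset.map_val, Multiset.map_map]
  rfl

lemma star_isTreeWithWeights (hW : ∀ w ∈ W, 0 < w) : (star W hW).IsTreeWithWeights W := by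
  refine ⟨SimpleGraph.isTree_starGraph none, ?_⟩
  rw [edgeWeights_of_center (G := star W hW) (z := none) (f := some)
    (fun x y => SimpleGraph.starGraph_adj) (Option.some_injective _)
    (fun x => Option.ne_none_iff_exists)]
  exact W.map_univ_coe

/-- A weighted tree whose underlying graph is a star is the star with its edge-weights. -/
lemma nonempty_iso_star {G : WeightedGraph V} (hW : ∀ w ∈ W, 0 < w) (hG : G.edgeWeights = W)
    {z : V} (hz : ∀ x y, G.graph.Adj x y ↔ x ≠ y ∧ (x = z ∨ y = z)) :
    Nonempty (G.Iso (star W hW)) := by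
  classical
  have hw := edgeWeights_of_center hz (f := fun x : {x // x ≠ z} => x.1)
    Subtype.val_injective (fun x => by simp)
  obtain ⟨σ, hσ⟩ := exists_equiv_of_map_univ_eq (hw.symm.trans (hG.trans W.map_univ_coe.symm))
  let φ : V ≃ Option W := (Equiv.optionSubtypeNe z).symm.trans (Equiv.optionCongr σ)
  have hφz : φ z = none := by simp [φ]
  have hφ : ∀ x (hx : x ≠ z), φ x = some (σ ⟨x, hx⟩) := by
    intro x hx
    simp [φ, hx]
  have hnone : ∀ x, φ x = none ↔ x = z := by
    intro x
    rw [← hφz, φ.injective.eq_iff]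
  refine ⟨⟨⟨φ, ?_⟩, fun x y => ?_⟩⟩
  · intro x y
    rw [hz]
    change (SimpleGraph.starGraph none).Adj _ _ ↔ _
    rw [SimpleGraph.starGraph_adj, hnone, hnone, φ.injective.ne_iff]
  · change (star W hW).weight s(φ x, φ y) = _
    by_cases hx : x = z
    · subst hx
      by_cases hy : y = x
      · subst hy
        rw [G.weight_eq_zero _ (by simp), (star W hW).weight_eq_zero _ (by simp)]
      · rw [hφz, hφ y hy]
        exact hσ ⟨y, hy⟩
    · by_cases hy : y = z
      · subst hy
        rw [hφz, hφ x hx, Sym2.eq_swap (a := x)]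
        exact hσ ⟨x, hx⟩
      · rw [G.weight_eq_zero _ (by simp [hz, hx, hy]), hφ x hx, hφ y hy]
        rfl

end Star

end WeightedGraph

theorem theorem2 (W : Multiset ℝ) (hW : ∀ w ∈ W, 0 < w) :
    -- polarized paths with the edge-weights `W` exist, and the star `S_W` has these edge-weights
    (∃ P : WeightedGraph (Fin (Multiset.card W + 1)),
      P.IsTreeWithWeights W ∧ P.IsPolarizedPath) ∧
    (WeightedGraph.star W hW).IsTreeWithWeights W ∧
    ∀ (V : Type u) [Fintype V] (T : WeightedGraph V), T.IsTreeWithWeights W →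
      -- the maximizers are exactly the polarized paths
      ((∀ (V' : Type v) [Fintype V'] (T' : WeightedGraph V'), T'.IsTreeWithWeights W →
          T'.averageHittingTime ≤ T.averageHittingTime) ↔ T.IsPolarizedPath) ∧
      -- the star is, up to isomorphism, the only minimizer
      ((∀ (V' : Type v) [Fintype V'] (T' : WeightedGraph V'), T'.IsTreeWithWeights W →
          T.averageHittingTime ≤ T'.averageHittingTime) ↔
        Nonempty (T.Iso (WeightedGraph.star W hW))) := by
  have hP := WeightedGraph.exists_isPolarizedPath W hW
  have hS := WeightedGraph.star_isTreeWithWeights hW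
  refine ⟨hP, hS, fun V _ T hT => ⟨⟨fun hmax => ?_, fun hpol V' _ T' hT' => ?_⟩,
    ⟨fun hmin => ?_, fun ⟨φ⟩ V' _ T' hT' => ?_⟩⟩⟩
  · -- comparison with a copy of a polarized path in the universe of the competitors
    obtain ⟨P, hPW, hPpol⟩ := hP
    let φ := P.isoTransport (Equiv.ulift.{v}.symm)
    have hle := hT.cutSum_le (φ.isTreeWithWeights hPW) (φ.isPolarizedPath hPpol)
    have h := hmax _ _ (φ.isTreeWithWeights hPW)
    rw [(φ.isTreeWithWeights hPW).averageHittingTime_le_iff hT hW] at h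
    exact hle.2 (hle.1.antisymm h)
  · rw [hT'.averageHittingTime_le_iff hT hW]
    exact (hT'.cutSum_le hT hpol).1
  · let φ := (WeightedGraph.star W hW).isoTransport (Equiv.ulift.{v}.symm)
    obtain ⟨c, hc⟩ := φ.exists_center_of_star
    have hle := hT.cutSum_star_le (φ.isTreeWithWeights hS) hc
    have h := hmin _ _ (φ.isTreeWithWeights hS)
    rw [hT.averageHittingTime_le_iff (φ.isTreeWithWeights hS) hW] at h
    obtain ⟨z, hz⟩ := hle.2 (h.antisymm hle.1)
    exact WeightedGraph.nonempty_iso_star hW hT.2 hz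
  · obtain ⟨c, hc⟩ := φ.symm.exists_center_of_star
    rw [hT.averageHittingTime_le_iff hT' hW]
    exact (hT'.cutSum_star_le hT hc).1
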